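/- Let $\mathbb K$ be a field and let $r,s\in\mathbb K$ be roots of unity: $r$ is a primitive $d$-th root of unity, $s$ is a primitive $d'$-th root of unity ($d,d'\ge 1$), and $\ell=\mathrm{lcm}(d,d')$. Assume $r^3\ne s^3$, $r^4\ne s^4$ and $r^2-rs+s^2\ne 0$. Put $r_1=r$, $s_1=s$, $r_2=r^3$, $s_2=s^3$. Let $U_{r,s}(G_2)$ be the associative unital $\mathbb K$-algebra generated by $e_i,f_i,\omega_i^{\pm1},\omega_i'^{\pm1}$ ($i=1,2$) subject to the following relations. (G1) The $\omega_i^{\pm1},\omega_j'^{\pm1}$ all commute with each other, and $\omega_i\omega_i^{-1}=1=\omega_i'\omega_i'^{-1}$. (G2) $\omega_ie_j\omega_i^{-1}=c_{ij}e_j$ and $\omega_if_j\omega_i^{-1}=c_{ij}^{-1}f_j$, where $c_{11}=rs^{-1}$, $c_{12}=s^3$, $c_{21}=r^{-3}$, $c_{22}=r^3s^{-3}$. (G3) $\omega'_ie_j\omega_i'^{-1}=c'_{ij}e_j$ and $\omega'_if_j\omega_i'^{-1}=c_{ij}'^{-1}f_j$, where $c'_{11}=r^{-1}s$, $c'_{12}=r^3$,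 $c'_{21}=s^{-3}$, $c'_{22}=r^{-3}s^3$. (G4) $e_if_j-f_je_i=\delta_{ij}\dfrac{\omega_i-\omega_i'}{r_i-s_i}$. (G5) $e_2^2e_1-(r^{-3}+s^{-3})e_2e_1e_2+(rs)^{-3}e_1e_2^2=0$ and $$e_1^4e_2-(r+s)(r^2+s^2)e_1^3e_2e_1+rs(r^2+s^2)(r^2+rs+s^2)e_1^2e_2e_1^2-(rs)^3(r+s)(r^2+s^2)e_1e_2e_1^3+(rs)^6e_2e_1^4=0.$$ (G6) $f_1f_2^2-(r^{-3}+s^{-3})f_2f_1f_2+(rs)^{-3}f_2^2f_1=0$ and $$f_2f_1^4-(r+s)(r^2+s^2)f_1f_2f_1^3+rs(r^2+s^2)(r^2+rs+s^2)f_1^2f_2f_1^2-(rs)^3(r+s)(r^2+s^2)f_1^3f_2f_1+(rs)^6f_1^4f_2=0.$$ Let $\Phi^+=\{\alpha_1,\,3\alpha_1+\alpha_2,\,2\alpha_1+\alpha_2,\,3\alpha_1+2\alpha_2,\,\alpha_1+\alpha_2,\,\alpha_2\}$ and define the quantum root vectors by $E_{\alpha_1}=e_1$, $E_{\alpha_2}=e_2$,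 $F_{\alpha_1}=f_1$, $F_{\alpha_2}=f_2$, $$\begin{aligned} E_{\alpha_1+\alpha_2}&=E_{12}=e_1e_2-s^3e_2e_1, & F_{\alpha_1+\alpha_2}&=F_{12}=f_2f_1-r^3f_1f_2,\\ E_{2\alpha_1+\alpha_2}&=E_{112}=e_1E_{12}-rs^2E_{12}e_1, & F_{2\alpha_1+\alpha_2}&=F_{112}=F_{12}f_1-r^2sf_1F_{12},\\ E_{3\alpha_1+\alpha_2}&=e_1E_{112}-r^2sE_{112}e_1, & F_{3\alpha_1+\alpha_2}&=F_{112}f_1-rs^2f_1F_{112},\\ E_{3\alpha_1+2\alpha_2}&=E_{112}E_{12}-r^2sE_{12}E_{112}, & F_{3\alpha_1+2\alpha_2}&=F_{12}F_{112}-rs^2F_{112}F_{12}. \end{aligned}$$ Theorem 3.2. The elements $E_\alpha^\ell$ and $F_\alpha^\ell$ ($\alpha\in\Phi^+$) and $\omega_k^\ell-1$, $(\omega_k')^\ell-1$ ($k=1,2$) are central in $U_{r,s}(G_2)$. -/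

import Mathlib

namespace TwoParamG2

/-- The generating symbols `e_i, f_i, ω_i^{±1}, ω'_i^{±1}` of `U_{r,s}(G_2)`.
The index `0 : Fin 2` stands for the short simple root `α₁`, `1 : Fin 2` for the long one `α₂`. -/
inductive Gen : Type
  | e (i : Fin 2)
  | f (i : Fin 2)
  | ω (i : Fin 2)
  | ωInv (i : Fin 2)
  | ω' (i : Fin 2)
  | ω'Inv (i : Fin 2)

/-- The symbols `ω_i^{±1}` and `ω'_i^{±1}`. -/
inductive Gen.IsToral : Gen → Prop
  | ω (i : Fin 2) : IsToral (Gen.ω i)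
  | ωInv (i : Fin 2) : IsToral (Gen.ωInv i)
  | ω' (i : Fin 2) : IsToral (Gen.ω' i)
  | ω'Inv (i : Fin 2) : IsToral (Gen.ω'Inv i)

section Presentation

variable {K : Type*} [Field K]

/-- The scalars `c_{ij}` with `ω_i e_j ω_i⁻¹ = c_{ij} e_j` and `ω_i f_j ω_i⁻¹ = c_{ij}⁻¹ f_j`. -/
def chi (r s : K) : Matrix (Fin 2) (Fin 2) K :=
  !![r * s⁻¹, s ^ 3; (r ^ 3)⁻¹, r ^ 3 * (s ^ 3)⁻¹]

/-- The scalars `c'_{ij}` with `ω'_i e_j ω'_i⁻¹ = c'_{ij} e_j` and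
`ω'_i f_j ω'_i⁻¹ = c'_{ij}⁻¹ f_j`. -/
def chi' (r s : K) : Matrix (Fin 2) (Fin 2) K :=
  !![r⁻¹ * s, r ^ 3; (s ^ 3)⁻¹, (r ^ 3)⁻¹ * s ^ 3]

/-- `r_1 = r` and `r_2 = r ^ 3` (and likewise `s_1 = s`, `s_2 = s ^ 3`). -/
def param (r : K) : Fin 2 → K := ![r, r ^ 3]

/-- A generating symbol as an element of the free algebra. -/
abbrev gen (K : Type*) [Field K] (g : Gen) : FreeAlgebra K Gen := FreeAlgebra.ι K g

open Gen in
/-- The defining relations of `U_{r,s}(G_2)`. -/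
inductive Rel (r s : K) : FreeAlgebra K Gen → FreeAlgebra K Gen → Prop
  -- the toral generators commute, and `ω_i⁻¹`, `ω'_i⁻¹` are inverse to `ω_i`, `ω'_i`
  | toral_comm (x y : Gen) (hx : x.IsToral) (hy : y.IsToral) :
      Rel r s (gen K x * gen K y) (gen K y * gen K x)
  | ω_inv (i : Fin 2) : Rel r s (gen K (ω i) * gen K (ωInv i)) 1
  | ω'_inv (i : Fin 2) : Rel r s (gen K (ω' i) * gen K (ω'Inv i)) 1
  -- conjugation by `ω_i`
  | ω_e (i j : Fin 2) :
      Rel r s (gen K (ω i) * gen K (e j) * gen K (ωInv i)) (chi r s i j • gen K (e j))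
  | ω_f (i j : Fin 2) :
      Rel r s (gen K (ω i) * gen K (f j) * gen K (ωInv i)) ((chi r s i j)⁻¹ • gen K (f j))
  -- conjugation by `ω'_i`
  | ω'_e (i j : Fin 2) :
      Rel r s (gen K (ω' i) * gen K (e j) * gen K (ω'Inv i)) (chi' r s i j • gen K (e j))
  | ω'_f (i j : Fin 2) :
      Rel r s (gen K (ω' i) * gen K (f j) * gen K (ω'Inv i)) ((chi' r s i j)⁻¹ • gen K (f j))
  -- `[e_i, f_j] = δ_{ij} (ω_i - ω'_i) / (r_i - s_i)`
  | e_f_same (i : Fin 2) :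
      Rel r s (gen K (e i) * gen K (f i) - gen K (f i) * gen K (e i))
        ((param r i - param s i)⁻¹ • (gen K (ω i) - gen K (ω' i)))
  | e_f_ne (i j : Fin 2) (hij : i ≠ j) :
      Rel r s (gen K (e i) * gen K (f j) - gen K (f j) * gen K (e i)) 0
  -- the `(r,s)`-Serre relations among `e_1`, `e_2`
  | serre_e₁ :
      Rel r s
        (gen K (e 1) ^ 2 * gen K (e 0)
          - ((r ^ 3)⁻¹ + (s ^ 3)⁻¹) • (gen K (e 1) * gen K (e 0) * gen K (e 1))
          + ((r * s) ^ 3)⁻¹ • (gen K (e 0) * gen K (e 1) ^ 2)) 0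
  | serre_e₂ :
      Rel r s
        (gen K (e 0) ^ 4 * gen K (e 1)
          - ((r + s) * (r ^ 2 + s ^ 2)) • (gen K (e 0) ^ 3 * gen K (e 1) * gen K (e 0))
          + (r * s * (r ^ 2 + s ^ 2) * (r ^ 2 + r * s + s ^ 2)) •
              (gen K (e 0) ^ 2 * gen K (e 1) * gen K (e 0) ^ 2)
          - ((r * s) ^ 3 * (r + s) * (r ^ 2 + s ^ 2)) •
              (gen K (e 0) * gen K (e 1) * gen K (e 0) ^ 3)
          + (r * s) ^ 6 • (gen K (e 1) * gen K (e 0) ^ 4)) 0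
  -- the `(r,s)`-Serre relations among `f_1`, `f_2`
  | serre_f₁ :
      Rel r s
        (gen K (f 0) * gen K (f 1) ^ 2
          - ((r ^ 3)⁻¹ + (s ^ 3)⁻¹) • (gen K (f 1) * gen K (f 0) * gen K (f 1))
          + ((r * s) ^ 3)⁻¹ • (gen K (f 1) ^ 2 * gen K (f 0))) 0
  | serre_f₂ :
      Rel r s
        (gen K (f 1) * gen K (f 0) ^ 4
          - ((r + s) * (r ^ 2 + s ^ 2)) • (gen K (f 0) * gen K (f 1) * gen K (f 0) ^ 3)
          + (r * s * (r ^ 2 + s ^ 2) * (r ^ 2 + r * s + s ^ 2)) •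
              (gen K (f 0) ^ 2 * gen K (f 1) * gen K (f 0) ^ 2)
          - ((r * s) ^ 3 * (r + s) * (r ^ 2 + s ^ 2)) •
              (gen K (f 0) ^ 3 * gen K (f 1) * gen K (f 0))
          + (r * s) ^ 6 • (gen K (f 0) ^ 4 * gen K (f 1))) 0

/-- The two-parameter quantum group `U_{r,s}(G_2)` as an associative unital `K`-algebra. -/
abbrev U (r s : K) : Type _ := RingQuot (Rel r s)

/-- The image of a generating symbol in `U_{r,s}(G_2)`. -/
def toU (r s : K) (g : Gen) : U r s := RingQuot.mkAlgHom K (Rel r s) (FreeAlgebra.ι K g)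

/-- The generator `e_i` of `U_{r,s}(G_2)`. -/
def e (r s : K) (i : Fin 2) : U r s := toU r s (Gen.e i)

/-- The generator `f_i` of `U_{r,s}(G_2)`. -/
def f (r s : K) (i : Fin 2) : U r s := toU r s (Gen.f i)

/-- The generator `ω_i` of `U_{r,s}(G_2)`. -/
def ω (r s : K) (i : Fin 2) : U r s := toU r s (Gen.ω i)

/-- The generator `ω'_i` of `U_{r,s}(G_2)`. -/
def ω' (r s : K) (i : Fin 2) : U r s := toU r s (Gen.ω' i)

end Presentation

/-- The six positive roots of `G_2`, in convex order:
`α₁, 3α₁ + α₂, 2α₁ + α₂, 3α₁ + 2α₂, α₁ + α₂, α₂`. -/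
inductive PosRoot : Type
  | α1
  | α1112
  | α112
  | α11212
  | α12
  | α2

section RootVectors

variable {K : Type*} [Field K] (r s : K)

/-- `E_{α₁+α₂} = e₁e₂ - s³e₂e₁`. -/
def E12 : U r s := e r s 0 * e r s 1 - s ^ 3 • (e r s 1 * e r s 0)

/-- `E_{2α₁+α₂} = e₁E₁₂ - rs²E₁₂e₁`. -/
def E112 : U r s := e r s 0 * E12 r s - (r * s ^ 2) • (E12 r s * e r s 0)

/-- `E_{3α₁+α₂} = e₁E₁₁₂ - r²sE₁₁₂e₁`. -/
def E1112 : U r s := e r s 0 * E112 r s - (r ^ 2 * s) • (E112 r s * e r s 0)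

/-- `E_{3α₁+2α₂} = E₁₁₂E₁₂ - r²sE₁₂E₁₁₂`. -/
def E11212 : U r s := E112 r s * E12 r s - (r ^ 2 * s) • (E12 r s * E112 r s)

/-- `F_{α₁+α₂} = f₂f₁ - r³f₁f₂`. -/
def F12 : U r s := f r s 1 * f r s 0 - r ^ 3 • (f r s 0 * f r s 1)

/-- `F_{2α₁+α₂} = F₁₂f₁ - r²sf₁F₁₂`. -/
def F112 : U r s := F12 r s * f r s 0 - (r ^ 2 * s) • (f r s 0 * F12 r s)

/-- `F_{3α₁+α₂} = F₁₁₂f₁ - rs²f₁F₁₁₂`. -/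
def F1112 : U r s := F112 r s * f r s 0 - (r * s ^ 2) • (f r s 0 * F112 r s)

/-- `F_{3α₁+2α₂} = F₁₂F₁₁₂ - rs²F₁₁₂F₁₂`. -/
def F11212 : U r s := F12 r s * F112 r s - (r * s ^ 2) • (F112 r s * F12 r s)

/-- The positive quantum root vectors `E_α`. -/
def E : PosRoot → U r s
  | .α1 => e r s 0
  | .α1112 => E1112 r s
  | .α112 => E112 r s
  | .α11212 => E11212 r s
  | .α12 => E12 r s
  | .α2 => e r s 1

/-- The negative quantum root vectors `F_α`. -/
def F : PosRoot → U r s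
  | .α1 => f r s 0
  | .α1112 => F1112 r s
  | .α112 => F112 r s
  | .α11212 => F11212 r s
  | .α12 => F12 r s
  | .α2 => f r s 1

end RootVectors

end TwoParamG2

/-!
# Central `ℓ`-th powers in `U_{r,s}(G₂)`

Let `L` and `R` be left and right multiplication by an element `y`. They commute, so if `x` is
killed by `∏ (L - cᵢ R)` for distinct `ℓ`-th roots of unity `cᵢ`, then `L ^ ℓ - R ^ ℓ`, being
divisible by that product, kills `x` too: `y ^ ℓ` commutes with `x`
(`commute_pow_of_mem_skewKer`). No `q`-binomial identity is needed, only the distinctness of the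
`cᵢ`.

For `y` a positive root vector and `x` a generator such a product exists because the iterated skew
commutators of `y` with `x` stop after a few steps. For `x = eᵢ` this follows from the
straightening (Levendorskii–Soibelman) relations between the six root vectors
(`RootVectorRel.Y_e2` up to `RootVectorRel.X_Z`). They all come from the Serre relations, read as
`e₁ X = r³ X e₁` and `V e₂ = r³ e₂ V`, by taking further skew commutators with `e₁` or `e₂`; the
divisions that occur are by `r + s`, `r² + s²` and `r² - r s + s²`. For `x = fᵢ` the first
commutator is a toral element times a polynomial in positive root vectors (`QuantumG2Rel.V_f1` up
to `QuantumG2Rel.Z_f2`), which is again handled by the straightening relations. The parameters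
`cᵢ` of each chain form a geometric progression with ratio `(s / r)^{±1}` for the short roots and
`(s³ / r³)^{±1}` for the long ones, of length at most four and three respectively, or are
`1, q, q⁻¹` when `x` is the opposite of a simple root vector. The hypotheses on `r`, `s` make them
distinct.

All this is carried out in an arbitrary `K`-algebra. The negative root vectors are then covered by
applying it to the opposite algebra, with `r`, `s` and `eᵢ`, `fᵢ` and `ωᵢ`, `ω'ᵢ` interchanged
(`quantumG2Rel_neg`).
-/

set_option linter.unusedSimpArgs false

namespace TwoParamG2

/-! ### Skew commutation with `ℓ`-th powers -/

section SkewKernel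

variable {K A : Type*} [Field K] [Ring A] [Algebra K A]

/-- The skew commutator `x ↦ y x - c x y` as a linear operator. -/
def skewComm (y : A) (c : K) : A →ₗ[K] A :=
  LinearMap.mulLeft K y - c • LinearMap.mulRight K y

/-- The kernel of a composite of skew commutators: `x ∈ skewKer y [c₀, …, cₙ]` if applying
`x ↦ y x - c₀ x y`, then `x ↦ y x - c₁ x y`, and so on, ends in `0`. -/
def skewKer (y : A) : List K → Submodule K A
  | [] => ⊥
  | c :: l => (skewKer y l).comap (skewComm y c)

theorem mem_skewKer_cons {y x x' : A} {c : K} {l : List K}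
    (h : y * x = c • (x * y) + x') (hx' : x' ∈ skewKer y l) : x ∈ skewKer y (c :: l) := by
  have : skewComm y c x = x' := by
    simp [skewComm, h]
  simpa [skewKer, this] using hx'

theorem mem_skewKer_of_skew {y x : A} {c : K} {l : List K} (h : y * x = c • (x * y)) :
    x ∈ skewKer y (c :: l) :=
  mem_skewKer_cons (x' := 0) (by simpa using h) (Submodule.zero_mem _)

/-- Factoring `Xⁿ - Yⁿ` in `K[X, Y]`, only those factors being kept that come from a given list
of distinct `n`-th roots of unity. -/
theorem prod_sub_smul_dvd_pow_sub_pow {B : Type*} [CommRing B] [Algebra K B] {n : ℕ} {ζ : K}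
    (hn : 0 < n) (hζ : IsPrimitiveRoot ζ n) {l : List K} (hl : l.Nodup) (hp : ∀ c ∈ l, c ^ n = 1)
    (a b : B) : (l.map fun c => a - c • b).prod ∣ a ^ n - b ^ n := by
  classical
  have hinj : Function.Injective (algebraMap K (MvPolynomial (Fin 2) K)) :=
    FaithfulSMul.algebraMap_injective K (MvPolynomial (Fin 2) K)
  have hζ' : IsPrimitiveRoot (algebraMap K (MvPolynomial (Fin 2) K) ζ) n :=
    hζ.map_of_injective hinj
  have hfac := hζ'.pow_sub_pow_eq_prod_sub_mul (MvPolynomial.X (R := K) (0 : Fin 2))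
    (MvPolynomial.X 1) hn
  have hsub : l.toFinset.image (algebraMap K (MvPolynomial (Fin 2) K)) ⊆
      Polynomial.nthRootsFinset n (1 : MvPolynomial (Fin 2) K) := by
    intro z hz
    obtain ⟨c, hc, rfl⟩ := Finset.mem_image.1 hz
    rw [Polynomial.mem_nthRootsFinset hn, ← map_pow, hp c (List.mem_toFinset.1 hc), map_one]
  have hdvd := Finset.prod_dvd_prod_of_subset _ _
    (fun z : MvPolynomial (Fin 2) K =>
      MvPolynomial.X (R := K) (0 : Fin 2) - z * MvPolynomial.X 1) hsub
  rw [← hfac, Finset.prod_image hinj.injOn, List.prod_toFinset _ hl] at hdvd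
  have hmap := map_dvd (MvPolynomial.aeval ![a, b] : MvPolynomial (Fin 2) K →ₐ[K] B) hdvd
  simpa [map_list_prod, List.map_map, Function.comp_def, Algebra.smul_def] using hmap

/-- If `x` is annihilated by skew commutators with `y` whose parameters are distinct `n`-th roots
of unity, then `yⁿ` commutes with `x`: left and right multiplication by `y` are commuting
operators `L`, `R`, and `∏ (L - cᵢ R)` divides `Lⁿ - Rⁿ`. -/
theorem commute_pow_of_mem_skewKer {n : ℕ} {ζ : K} (hn : 0 < n) (hζ : IsPrimitiveRoot ζ n)
    {l : List K} (hl : l.Nodup) (hp : ∀ c ∈ l, c ^ n = 1) {y x : A} (hx : x ∈ skewKer y l) :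
    Commute (y ^ n) x := by
  let L : Module.End K A := LinearMap.mulLeft K y
  let R : Module.End K A := LinearMap.mulRight K y
  have hLR : L * R = R * L := by
    ext z
    simp [L, R, mul_assoc]
  have hcomm : ∀ a ∈ ({L, R} : Set (Module.End K A)), ∀ b ∈ ({L, R} : Set (Module.End K A)),
      a * b = b * a := by
    rintro a (rfl | rfl) b (rfl | rfl)
    · rfl
    · exact hLR
    · exact hLR.symm
    · rfl
  let B := Algebra.adjoin K ({L, R} : Set (Module.End K A))
  have hB : IsMulCommutative B := Algebra.isMulCommutative_adjoin K hcomm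
  let _ : CommRing B := { (inferInstance : Ring B) with mul_comm := hB.is_comm.comm }
  let a : B := ⟨L, Algebra.subset_adjoin (by simp)⟩
  let b : B := ⟨R, Algebra.subset_adjoin (by simp)⟩
  -- On the commutative algebra generated by `L` and `R` the factorization applies.
  obtain ⟨g, hg⟩ := prod_sub_smul_dvd_pow_sub_pow hn hζ hl hp a b
  have hker : ∀ (l : List K) (x : A), x ∈ skewKer y l →
      ((l.map fun c => a - c • b).prod : B).1 x = 0 := by
    intro l
    induction l with
    | nil => intro x hx; simpa [skewKer] using hx
    | cons c l ih =>
      intro x hx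
      rw [List.map_cons, List.prod_cons, mul_comm]
      exact ih _ hx
  have h0 : (a ^ n - b ^ n : B).1 x = 0 := by
    rw [hg, mul_comm]
    change g.1 (_) = 0
    rw [hker l x hx, map_zero]
  have h1 : (a ^ n - b ^ n : B).1 = L ^ n - R ^ n := rfl
  rw [h1, LinearMap.sub_apply, LinearMap.pow_mulLeft, LinearMap.pow_mulRight] at h0
  exact sub_eq_zero.1 h0

end SkewKernel
/-! ### Straightening relations between the root vectors -/

section Positive

variable {K A : Type*} [Field K] [Ring A] [Algebra K A]

/-- Nondegeneracy of the parameters: they are nonzero, and `r / s` is not a zero of the cyclotomic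
polynomials `Φ₁`, `Φ₂`, `Φ₃`, `Φ₄`, `Φ₆`. -/
structure Generic (r s : K) : Prop where
  r_ne : r ≠ 0
  s_ne : s ≠ 0
  cube_ne : r ^ 3 ≠ s ^ 3
  fourth_ne : r ^ 4 ≠ s ^ 4
  quad_ne : r ^ 2 + s ^ 2 - r * s ≠ 0

namespace Generic

variable {r s : K}

theorem symm (h : Generic r s) : Generic s r :=
  ⟨h.s_ne, h.r_ne, h.cube_ne.symm, h.fourth_ne.symm, by
    have := h.quad_ne
    rwa [add_comm, mul_comm]⟩

theorem sub_ne (h : Generic r s) : r - s ≠ 0 :=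
  fun h0 => h.cube_ne (by rw [sub_eq_zero.1 h0])

theorem add_ne (h : Generic r s) : r + s ≠ 0 :=
  fun h0 => h.fourth_ne (by linear_combination (r ^ 2 + s ^ 2) * (r - s) * h0)

theorem sq_add_ne (h : Generic r s) : r ^ 2 + s ^ 2 ≠ 0 :=
  fun h0 => h.fourth_ne (by linear_combination (r ^ 2 - s ^ 2) * h0)

theorem cube_sub_ne (h : Generic r s) : r ^ 3 - s ^ 3 ≠ 0 := sub_ne_zero.2 h.cube_ne

end Generic

/-- Two elements `e₁`, `e₂` satisfying the `(r,s)`-Serre relations, together with the root vectors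
`V`, `Y`, `X`, `Z` for `α₁+α₂`, `2α₁+α₂`, `3α₁+α₂`, `3α₁+2α₂` that they define. The Serre relations
are recorded as the skew commutations `e1_X` and `V_e2`. -/
structure RootVectorRel (r s : K) (e₁ e₂ V Y X Z : A) : Prop where
  e1_e2 : e₁ * e₂ = s ^ 3 • (e₂ * e₁) + V
  e1_V : e₁ * V = (r * s ^ 2) • (V * e₁) + Y
  e1_Y : e₁ * Y = (r ^ 2 * s) • (Y * e₁) + X
  Y_V : Y * V = (r ^ 2 * s) • (V * Y) + Z
  e1_X : e₁ * X = r ^ 3 • (X * e₁)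
  V_e2 : V * e₂ = r ^ 3 • (e₂ * V)

namespace RootVectorRel

variable {r s : K} {e₁ e₂ V Y X Z : A}

theorem Y_e2 (h : RootVectorRel r s e₁ e₂ V Y X Z) :
    Y * e₂ = (r ^ 3 * s ^ 3) • (e₂ * Y) + (r * (r ^ 2 - s ^ 2)) • (V * V) := by
  linear_combination (norm := (
      simp only [mul_add, add_mul, mul_sub, sub_mul, smul_mul_assoc, mul_smul_comm, mul_assoc,
        smul_add, smul_sub, smul_smul]
      module))
    -(h.e1_V * e₂) + e₁ * h.V_e2 - (r * s ^ 2) • (V * h.e1_e2) - (r * s ^ 5) • (h.V_e2 * e₁)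
      + r ^ 3 • (h.e1_e2 * V) + (r ^ 3 * s ^ 3) • (e₂ * h.e1_V)

/-- Obtained from `Y_e2` by skew commutation with `e₁`. -/
theorem X_e2 (h : RootVectorRel r s e₁ e₂ V Y X Z) :
    X * e₂ = (r ^ 3 * s ^ 6) • (e₂ * X) + (r ^ 3 - r * s ^ 2 - r ^ 2 * s) • (Y * V)
      + (r ^ 2 * s ^ 2 * (r ^ 2 + r * s - s ^ 2)) • (V * Y) := by
  linear_combination (norm := (
      simp only [mul_add, add_mul, mul_sub, sub_mul, smul_mul_assoc, mul_smul_comm, mul_assoc,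
        smul_add, smul_sub, smul_smul]
      module))
    -(h.e1_Y * e₂) + e₁ * h.Y_e2 - (r ^ 2 * s) • (Y * h.e1_e2) - (r ^ 2 * s ^ 4) • (h.Y_e2 * e₁)
      + (r ^ 3 * s ^ 3) • (h.e1_e2 * Y) + (r ^ 3 * s ^ 6) • (e₂ * h.e1_Y)
      + (r * (r ^ 2 - s ^ 2)) • (h.e1_V * V)
      + (r * (r ^ 2 - s ^ 2) * (r * s ^ 2)) • (V * h.e1_V)

/-- Obtained from `X_e2` by skew commutation with `e₁`, after division by `r s (r + s)`. -/
theorem X_V (h : RootVectorRel r s e₁ e₂ V Y X Z) (hg : Generic r s) :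
    X * V = (r ^ 3 * s ^ 3) • (V * X) + (r * (r ^ 3 - s ^ 3) / (r + s)) • (Y * Y) := by
  have hr := hg.r_ne
  have hs := hg.s_ne
  have ha := hg.add_ne
  refine smul_right_injective A (mul_ne_zero (mul_ne_zero hr hs) ha) ?_
  beta_reduce
  linear_combination (norm := (
      simp only [mul_add, add_mul, mul_sub, sub_mul, smul_mul_assoc, mul_smul_comm, mul_assoc,
        smul_add, smul_sub, smul_smul]
      match_scalars <;> field_simp <;> ring))
    e₁ * h.X_e2 - h.e1_X * e₂ - r ^ 3 • (X * h.e1_e2) - (r ^ 3 * s ^ 3) • (h.X_e2 * e₁)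
      + (r ^ 3 * s ^ 6) • (h.e1_e2 * X) + (r ^ 3 * s ^ 9) • (e₂ * h.e1_X)
      + (r ^ 3 - r * s ^ 2 - r ^ 2 * s) • (h.e1_Y * V)
      + ((r ^ 3 - r * s ^ 2 - r ^ 2 * s) * (r ^ 2 * s)) • (Y * h.e1_V)
      + (r ^ 2 * s ^ 2 * (r ^ 2 + r * s - s ^ 2)) • (h.e1_V * Y)
      + (r ^ 2 * s ^ 2 * (r ^ 2 + r * s - s ^ 2) * (r * s ^ 2)) • (V * h.e1_Y)

/-- The scalar to be divided by in `X_Y` and `Y_Z`; it equals `r s (r² + s²) / (r + s)`. -/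
theorem coeff_ne (hg : Generic r s) : r ^ 3 - r * (r ^ 3 - s ^ 3) / (r + s) ≠ 0 := by
  have ha := hg.add_ne
  have : r ^ 3 - r * (r ^ 3 - s ^ 3) / (r + s) = r * s * (r ^ 2 + s ^ 2) / (r + s) := by
    field_simp
    ring
  rw [this]
  exact div_ne_zero (mul_ne_zero (mul_ne_zero hg.r_ne hg.s_ne) hg.sq_add_ne) ha

/-- Obtained from `X_V` by skew commutation with `e₁`, after division by `r² + s²`. -/
theorem X_Y (h : RootVectorRel r s e₁ e₂ V Y X Z) (hg : Generic r s) :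
    X * Y = r ^ 3 • (Y * X) := by
  have ha := hg.add_ne
  refine smul_right_injective A (coeff_ne hg) ?_
  beta_reduce
  linear_combination (norm := (
      simp only [mul_add, add_mul, mul_sub, sub_mul, smul_mul_assoc, mul_smul_comm, mul_assoc,
        smul_add, smul_sub, smul_smul]
      match_scalars <;> field_simp <;> ring))
    e₁ * h.X_V hg - h.e1_X * V - r ^ 3 • (X * h.e1_V) - (r ^ 4 * s ^ 2) • (h.X_V hg * e₁)
      + (r ^ 3 * s ^ 3) • (h.e1_V * X) + (r ^ 4 * s ^ 5) • (V * h.e1_X)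
      + (r * (r ^ 3 - s ^ 3) / (r + s)) • (h.e1_Y * Y)
      + (r * (r ^ 3 - s ^ 3) / (r + s) * (r ^ 2 * s)) • (Y * h.e1_Y)

/-- Obtained by multiplying `X_V` by `e₂`, after division by `r² - r s + s²`. -/
theorem Z_V (h : RootVectorRel r s e₁ e₂ V Y X Z) (hg : Generic r s) :
    Z * V = r ^ 3 • (V * Z) := by
  have hr := hg.r_ne
  have hs := hg.s_ne
  have ha := hg.add_ne
  refine smul_right_injective A (mul_ne_zero (mul_ne_zero (pow_ne_zero 2 hr) (pow_ne_zero 2 hs))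
    (neg_ne_zero.2 hg.quad_ne)) ?_
  beta_reduce
  linear_combination (norm := (
      simp only [mul_add, add_mul, mul_sub, sub_mul, smul_mul_assoc, mul_smul_comm, mul_assoc,
        smul_add, smul_sub, smul_smul]
      match_scalars <;> field_simp <;> ring))
    h.X_V hg * e₂ - X * h.V_e2 - r ^ 3 • (h.X_e2 * V) + (r ^ 3 * s ^ 3) • (V * h.X_e2)
      + (r ^ 6 * s ^ 9) • (h.V_e2 * X) - (r ^ 6 * s ^ 6) • (e₂ * h.X_V hg)
      + (r * (r ^ 3 - s ^ 3) / (r + s)) • (Y * h.Y_e2)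
      + (r * (r ^ 3 - s ^ 3) / (r + s) * (r ^ 3 * s ^ 3)) • (h.Y_e2 * Y)
      + (r ^ 2 * s ^ 2 * (r ^ 2 + s ^ 2 - r * s)) • (h.Y_V * V)
      - (r ^ 5 * s ^ 2 * (r ^ 2 + s ^ 2 - r * s)) • (V * h.Y_V)

theorem Z_e2 (h : RootVectorRel r s e₁ e₂ V Y X Z) :
    Z * e₂ = (r ^ 6 * s ^ 3) • (e₂ * Z)
      + (r * (r ^ 2 - s ^ 2) * (r ^ 3 - r ^ 2 * s)) • (V * (V * V)) := by
  linear_combination (norm := (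
      simp only [mul_add, add_mul, mul_sub, sub_mul, smul_mul_assoc, mul_smul_comm, mul_assoc,
        smul_add, smul_sub, smul_smul]
      module))
    -(h.Y_V * e₂) + Y * h.V_e2 + r ^ 3 • (h.Y_e2 * V) + (r ^ 6 * s ^ 3) • (e₂ * h.Y_V)
      - (r ^ 2 * s) • (V * h.Y_e2) - (r ^ 5 * s ^ 4) • (h.V_e2 * Y)

theorem e1_Z (h : RootVectorRel r s e₁ e₂ V Y X Z) (hg : Generic r s) :
    e₁ * Z = (r ^ 3 * s ^ 3) • (Z * e₁) + (r * (r ^ 3 - s ^ 3) / (r + s)) • (Y * Y) := by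
  linear_combination (norm := (
      simp only [mul_add, add_mul, mul_sub, sub_mul, smul_mul_assoc, mul_smul_comm, mul_assoc,
        smul_add, smul_sub, smul_smul]
      module))
    -(e₁ * h.Y_V) + h.e1_Y * V + (r ^ 2 * s) • (Y * h.e1_V) - (r ^ 2 * s) • (h.e1_V * Y)
      - (r ^ 3 * s ^ 3) • (V * h.e1_Y) + h.X_V hg + (r ^ 3 * s ^ 3) • (h.Y_V * e₁)

/-- Obtained from `Z_V` by skew commutation with `e₁`, after division by `r² + s²`. -/
theorem Y_Z (h : RootVectorRel r s e₁ e₂ V Y X Z) (hg : Generic r s) :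
    Y * Z = r ^ 3 • (Z * Y) := by
  have ha := hg.add_ne
  refine smul_right_injective A (coeff_ne hg) ?_
  beta_reduce
  linear_combination (norm := (
      simp only [mul_add, add_mul, mul_sub, sub_mul, smul_mul_assoc, mul_smul_comm, mul_assoc,
        smul_add, smul_sub, smul_smul]
      match_scalars <;> field_simp <;> ring))
    -(e₁ * h.Z_V hg) + h.e1_Z hg * V + (r ^ 3 * s ^ 3) • (Z * h.e1_V)
      + (r ^ 4 * s ^ 5) • (h.Z_V hg * e₁) - r ^ 3 • (h.e1_V * Z)
      - (r ^ 4 * s ^ 2) • (V * h.e1_Z hg) + (r * (r ^ 3 - s ^ 3) / (r + s)) • (Y * h.Y_V)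
      + (r * (r ^ 3 - s ^ 3) / (r + s) * (r ^ 2 * s)) • (h.Y_V * Y)

theorem X_Z (h : RootVectorRel r s e₁ e₂ V Y X Z) (hg : Generic r s) :
    X * Z = (r ^ 6 * s ^ 3) • (Z * X)
      + (r * (r ^ 3 - s ^ 3) / (r + s) * (r ^ 3 - r ^ 2 * s)) • (Y * (Y * Y)) := by
  linear_combination (norm := (
      simp only [mul_add, add_mul, mul_sub, sub_mul, smul_mul_assoc, mul_smul_comm, mul_assoc,
        smul_add, smul_sub, smul_smul]
      module))
    -(X * h.Y_V) + h.X_Y hg * V + r ^ 3 • (Y * h.X_V hg) - (r ^ 2 * s) • (h.X_V hg * Y)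
      - (r ^ 5 * s ^ 4) • (V * h.X_Y hg) + (r ^ 6 * s ^ 3) • (h.Y_V * X)

/-- An element skew commuting with `e₁`, `e₂` skew commutes with every root vector. -/
theorem weight (h : RootVectorRel r s e₁ e₂ V Y X Z) {g : A} {a b : K}
    (h₁ : g * e₁ = a • (e₁ * g)) (h₂ : g * e₂ = b • (e₂ * g)) :
    g * V = (a * b) • (V * g) ∧ g * Y = (a ^ 2 * b) • (Y * g) ∧
      g * X = (a ^ 3 * b) • (X * g) ∧ g * Z = (a ^ 3 * b ^ 2) • (Z * g) := by
  have hV : g * V = (a * b) • (V * g) := by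
    linear_combination (norm := (
        simp only [mul_add, add_mul, mul_sub, sub_mul, smul_mul_assoc, mul_smul_comm, mul_assoc,
          smul_add, smul_sub, smul_smul]
        module))
      -(g * h.e1_e2) + h₁ * e₂ + a • (e₁ * h₂) - s ^ 3 • (h₂ * e₁) - (s ^ 3 * b) • (e₂ * h₁)
        + (a * b) • (h.e1_e2 * g)
  have hY : g * Y = (a ^ 2 * b) • (Y * g) := by
    linear_combination (norm := (
        simp only [mul_add, add_mul, mul_sub, sub_mul, smul_mul_assoc, mul_smul_comm, mul_assoc,
          smul_add, smul_sub, smul_smul]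
        module))
      -(g * h.e1_V) + h₁ * V + a • (e₁ * hV) - (r * s ^ 2) • (hV * e₁)
        - (r * s ^ 2 * (a * b)) • (V * h₁) + (a ^ 2 * b) • (h.e1_V * g)
  refine ⟨hV, hY, ?_, ?_⟩
  · linear_combination (norm := (
        simp only [mul_add, add_mul, mul_sub, sub_mul, smul_mul_assoc, mul_smul_comm, mul_assoc,
          smul_add, smul_sub, smul_smul]
        module))
      -(g * h.e1_Y) + h₁ * Y + a • (e₁ * hY) - (r ^ 2 * s) • (hY * e₁)
        - (r ^ 2 * s * (a ^ 2 * b)) • (Y * h₁) + (a ^ 3 * b) • (h.e1_Y * g)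
  · linear_combination (norm := (
        simp only [mul_add, add_mul, mul_sub, sub_mul, smul_mul_assoc, mul_smul_comm, mul_assoc,
          smul_add, smul_sub, smul_smul]
        module))
      -(g * h.Y_V) + hY * V + (a ^ 2 * b) • (Y * hV) - (r ^ 2 * s) • (hV * Y)
        - (r ^ 2 * s * (a * b)) • (V * hY) + (a ^ 3 * b ^ 2) • (h.Y_V * g)

end RootVectorRel

end Positive

/-! ### Commutators of the root vectors with `f₁` and `f₂` -/

section Mixed

variable {K A : Type*} [Field K] [Ring A] [Algebra K A]

/-- Root vectors as in `RootVectorRel`, together with elements `f₁`, `f₂` and toral elements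
`w₁`, `w₂`, `v₁`, `v₂` (standing for `ω₁`, `ω₂`, `ω'₁`, `ω'₂`) satisfying the relations of
`U_{r,s}(G₂)` that involve `e₁` or `e₂`. Neither invertibility of the toral elements nor any
relation among `f₁`, `f₂` is required. -/
structure QuantumG2Rel (r s : K) (e₁ e₂ V Y X Z f₁ f₂ w₁ w₂ v₁ v₂ : A) : Prop
    extends RootVectorRel r s e₁ e₂ V Y X Z where
  e1_f1 : e₁ * f₁ = f₁ * e₁ + (r - s)⁻¹ • (w₁ - v₁)
  e1_f2 : e₁ * f₂ = f₂ * e₁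
  e2_f1 : e₂ * f₁ = f₁ * e₂
  e2_f2 : e₂ * f₂ = f₂ * e₂ + (r ^ 3 - s ^ 3)⁻¹ • (w₂ - v₂)
  w1_e1 : w₁ * e₁ = (r * s⁻¹) • (e₁ * w₁)
  w1_e2 : w₁ * e₂ = s ^ 3 • (e₂ * w₁)
  w2_e1 : w₂ * e₁ = (r ^ 3)⁻¹ • (e₁ * w₂)
  w2_e2 : w₂ * e₂ = (r ^ 3 * (s ^ 3)⁻¹) • (e₂ * w₂)
  v1_e1 : v₁ * e₁ = (r⁻¹ * s) • (e₁ * v₁)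
  v1_e2 : v₁ * e₂ = r ^ 3 • (e₂ * v₁)
  v2_e1 : v₂ * e₁ = (s ^ 3)⁻¹ • (e₁ * v₂)
  v2_e2 : v₂ * e₂ = ((r ^ 3)⁻¹ * s ^ 3) • (e₂ * v₂)

namespace QuantumG2Rel

variable {r s : K} {e₁ e₂ V Y X Z f₁ f₂ w₁ w₂ v₁ v₂ : A}

theorem V_f1 (h : QuantumG2Rel r s e₁ e₂ V Y X Z f₁ f₂ w₁ w₂ v₁ v₂) (hg : Generic r s) :
    V * f₁ = f₁ * V - (r ^ 2 + r * s + s ^ 2) • (e₂ * v₁) := by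
  have hd := hg.sub_ne
  linear_combination (norm := (
      simp only [mul_add, add_mul, mul_sub, sub_mul, smul_mul_assoc, mul_smul_comm, mul_assoc,
        smul_add, smul_sub, smul_smul]
      match_scalars <;> field_simp <;> ring))
    -(h.e1_e2 * f₁) + e₁ * h.e2_f1 + h.e1_f1 * e₂ + f₁ * h.e1_e2 - s ^ 3 • (e₂ * h.e1_f1)
      - s ^ 3 • (h.e2_f1 * e₁) + (r - s)⁻¹ • h.w1_e2 - (r - s)⁻¹ • h.v1_e2

theorem Y_f1 (h : QuantumG2Rel r s e₁ e₂ V Y X Z f₁ f₂ w₁ w₂ v₁ v₂) (hg : Generic r s) :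
    Y * f₁ = f₁ * Y - (r + s) ^ 2 • (V * v₁) := by
  have hr := hg.r_ne
  have hd := hg.sub_ne
  linear_combination (norm := (
      simp only [mul_add, add_mul, mul_sub, sub_mul, smul_mul_assoc, mul_smul_comm, mul_assoc,
        smul_add, smul_sub, smul_smul]
      match_scalars <;> field_simp <;> ring))
    -(h.e1_V * f₁) + e₁ * h.V_f1 hg + h.e1_f1 * V - (r * s ^ 2) • (V * h.e1_f1)
      - (r * s ^ 2) • (h.V_f1 hg * e₁) + f₁ * h.e1_V + (r - s)⁻¹ • (h.weight h.w1_e1 h.w1_e2).1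
      - (r - s)⁻¹ • (h.weight h.v1_e1 h.v1_e2).1 - (r ^ 2 + r * s + s ^ 2) • (h.e1_e2 * v₁)
      + (r * s ^ 2 * (r ^ 2 + r * s + s ^ 2)) • (e₂ * h.v1_e1)

theorem X_f1 (h : QuantumG2Rel r s e₁ e₂ V Y X Z f₁ f₂ w₁ w₂ v₁ v₂) (hg : Generic r s) :
    X * f₁ = f₁ * X - (r ^ 2 + r * s + s ^ 2) • (Y * v₁) := by
  have hd := hg.sub_ne
  linear_combination (norm := (
      simp only [mul_add, add_mul, mul_sub, sub_mul, smul_mul_assoc, mul_smul_comm, mul_assoc,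
        smul_add, smul_sub, smul_smul]
      match_scalars <;> field_simp <;> ring))
    -(h.e1_Y * f₁) + e₁ * h.Y_f1 hg + h.e1_f1 * Y - (r ^ 2 * s) • (Y * h.e1_f1)
      - (r ^ 2 * s) • (h.Y_f1 hg * e₁) + f₁ * h.e1_Y
      + (r - s)⁻¹ • (h.weight h.w1_e1 h.w1_e2).2.1
      - (r - s)⁻¹ • (h.weight h.v1_e1 h.v1_e2).2.1 - (r + s) ^ 2 • (h.e1_V * v₁)
      + (r ^ 2 * s * (r + s) ^ 2) • (V * h.v1_e1)

theorem Z_f1 (h : QuantumG2Rel r s e₁ e₂ V Y X Z f₁ f₂ w₁ w₂ v₁ v₂) (hg : Generic r s) :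
    Z * f₁ = f₁ * Z
      - ((r ^ 2 + r * s + s ^ 2) * (r * (r ^ 2 - s ^ 2))) • (V * (V * v₁)) := by
  linear_combination (norm := (
      simp only [mul_add, add_mul, mul_sub, sub_mul, smul_mul_assoc, mul_smul_comm, mul_assoc,
        smul_add, smul_sub, smul_smul]
      match_scalars <;> field_simp <;> ring))
    -(h.Y_V * f₁) + Y * h.V_f1 hg + h.Y_f1 hg * V - (r ^ 2 * s) • (V * h.Y_f1 hg)
      - (r ^ 2 * s) • (h.V_f1 hg * Y) + f₁ * h.Y_V
      - (r + s) ^ 2 • (V * (h.weight h.v1_e1 h.v1_e2).1)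
      - (r ^ 2 + r * s + s ^ 2) • (h.Y_e2 * v₁)
      + (r ^ 2 * s * (r ^ 2 + r * s + s ^ 2)) • (e₂ * (h.weight h.v1_e1 h.v1_e2).2.1)

theorem V_f2 (h : QuantumG2Rel r s e₁ e₂ V Y X Z f₁ f₂ w₁ w₂ v₁ v₂) (hg : Generic r s) :
    V * f₂ = f₂ * V + (r ^ 3)⁻¹ • (e₁ * w₂) := by
  have hr := hg.r_ne
  have hs := hg.s_ne
  have hd := hg.cube_sub_ne
  linear_combination (norm := (
      simp only [mul_add, add_mul, mul_sub, sub_mul, smul_mul_assoc, mul_smul_comm, mul_assoc,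
        smul_add, smul_sub, smul_smul]
      match_scalars <;> field_simp <;> ring))
    -(h.e1_e2 * f₂) + e₁ * h.e2_f2 + h.e1_f2 * e₂ + f₂ * h.e1_e2 - s ^ 3 • (e₂ * h.e1_f2)
      - s ^ 3 • (h.e2_f2 * e₁) - (s ^ 3 * (r ^ 3 - s ^ 3)⁻¹) • h.w2_e1
      + (s ^ 3 * (r ^ 3 - s ^ 3)⁻¹) • h.v2_e1

theorem Y_f2 (h : QuantumG2Rel r s e₁ e₂ V Y X Z f₁ f₂ w₁ w₂ v₁ v₂) (hg : Generic r s) :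
    Y * f₂ = f₂ * Y + ((r ^ 3)⁻¹ * (1 - s ^ 2 / r ^ 2)) • (e₁ * (e₁ * w₂)) := by
  linear_combination (norm := (
      simp only [mul_add, add_mul, mul_sub, sub_mul, smul_mul_assoc, mul_smul_comm, mul_assoc,
        smul_add, smul_sub, smul_smul]
      match_scalars <;> field_simp <;> ring))
    -(h.e1_V * f₂) + e₁ * h.V_f2 hg + h.e1_f2 * V - (r * s ^ 2) • (V * h.e1_f2)
      - (r * s ^ 2) • (h.V_f2 hg * e₁) + f₂ * h.e1_V
      - (r * s ^ 2 * (r ^ 3)⁻¹) • (e₁ * h.w2_e1)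

theorem X_f2 (h : QuantumG2Rel r s e₁ e₂ V Y X Z f₁ f₂ w₁ w₂ v₁ v₂) (hg : Generic r s) :
    X * f₂ = f₂ * X
      + ((r ^ 3)⁻¹ * (1 - s ^ 2 / r ^ 2) * (1 - s / r)) • (e₁ * (e₁ * (e₁ * w₂))) := by
  linear_combination (norm := (
      simp only [mul_add, add_mul, mul_sub, sub_mul, smul_mul_assoc, mul_smul_comm, mul_assoc,
        smul_add, smul_sub, smul_smul]
      match_scalars <;> field_simp <;> ring))
    -(h.e1_Y * f₂) + e₁ * h.Y_f2 hg + h.e1_f2 * Y - (r ^ 2 * s) • (Y * h.e1_f2)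
      - (r ^ 2 * s) • (h.Y_f2 hg * e₁) + f₂ * h.e1_Y
      - (r ^ 2 * s * ((r ^ 3)⁻¹ * (1 - s ^ 2 / r ^ 2))) • (e₁ * (e₁ * h.w2_e1))

/-- The commutator of `Z` with `f₂` is a combination of `X w₂` and `Y e₁ w₂`; the values of the
coefficients play no role. -/
theorem Z_f2 (h : QuantumG2Rel r s e₁ e₂ V Y X Z f₁ f₂ w₁ w₂ v₁ v₂) (hg : Generic r s) :
    ∃ α β : K, Z * f₂ = f₂ * Z + (α • (X * w₂) + β • (Y * (e₁ * w₂))) := by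
  have hw := h.weight h.w2_e1 h.w2_e2
  let c : K := (r ^ 3)⁻¹ * (1 - s ^ 2 / r ^ 2) * (s ^ 3)⁻¹
  let α : K := c - (r ^ 4 * s ^ 2)⁻¹
  refine ⟨α, c * (r * s ^ 2) + (r ^ 3)⁻¹ + r ^ 2 * s * α, ?_⟩
  simp only [α, c]
  linear_combination (norm := (
      simp only [mul_add, add_mul, mul_sub, sub_mul, smul_mul_assoc, mul_smul_comm, mul_assoc,
        smul_add, smul_sub, smul_smul]
      match_scalars <;> field_simp <;> ring))
    -(h.Y_V * f₂) + Y * h.V_f2 hg + h.Y_f2 hg * V - (r ^ 2 * s) • (V * h.Y_f2 hg)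
      - (r ^ 2 * s) • (h.V_f2 hg * Y) + f₂ * h.Y_V
      + ((r ^ 3)⁻¹ * (1 - s ^ 2 / r ^ 2)) • (e₁ * (e₁ * hw.1))
      - (r ^ 2 * s * (r ^ 3)⁻¹) • (e₁ * hw.2.1)
      + ((r ^ 3)⁻¹ * (1 - s ^ 2 / r ^ 2) * (s ^ 3)⁻¹) • (e₁ * (h.e1_V * w₂))
      + ((r ^ 3)⁻¹ * (1 - s ^ 2 / r ^ 2) * (s ^ 3)⁻¹ * (r * s ^ 2)) • (h.e1_V * (e₁ * w₂))
      + ((r ^ 3)⁻¹ * (1 - s ^ 2 / r ^ 2) * (s ^ 3)⁻¹ - (r ^ 4 * s ^ 2)⁻¹) • (h.e1_Y * w₂)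

end QuantumG2Rel

end Mixed

/-! ### Centrality of the powers of the root vectors -/

section Powers

variable {K A : Type*} [Field K] [Ring A] [Algebra K A]

/-- Nondegenerate parameters `r`, `s` that are `n`-th roots of unity in a field containing a
primitive `n`-th root of unity. -/
structure TorsionParam (r s : K) (n : ℕ) : Prop extends Generic r s where
  pos : 0 < n
  exists_primitive : ∃ ζ : K, IsPrimitiveRoot ζ n
  r_pow : r ^ n = 1
  s_pow : s ^ n = 1

namespace TorsionParam

variable {r s : K} {n : ℕ}

theorem symm (h : TorsionParam r s n) : TorsionParam s r n :=
  { h.toGeneric.symm with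
    pos := h.pos
    exists_primitive := h.exists_primitive
    r_pow := h.s_pow
    s_pow := h.r_pow }

theorem div_ne (h : TorsionParam r s n) : s / r ≠ 1 ∧ (s / r) ^ 2 ≠ 1 ∧ (s / r) ^ 3 ≠ 1 := by
  have hr := h.r_ne
  refine ⟨fun h0 => h.cube_ne ?_, fun h0 => h.fourth_ne ?_, fun h0 => h.cube_ne ?_⟩
  · rw [(div_eq_one_iff_eq hr).1 h0]
  · rw [div_pow, div_eq_one_iff_eq (pow_ne_zero 2 hr)] at h0
    linear_combination -(r ^ 2 + s ^ 2) * h0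
  · rw [div_pow, div_eq_one_iff_eq (pow_ne_zero 3 hr)] at h0
    exact h0.symm

theorem cube_div_ne (h : TorsionParam r s n) :
    s ^ 3 / r ^ 3 ≠ 1 ∧ (s ^ 3 / r ^ 3) ^ 2 ≠ 1 := by
  have hr := pow_ne_zero 3 h.r_ne
  refine ⟨fun h0 => h.cube_ne ((div_eq_one_iff_eq hr).1 h0).symm, fun h0 => ?_⟩
  rw [div_pow, div_eq_one_iff_eq (pow_ne_zero 2 hr)] at h0
  have : (r ^ 3 - s ^ 3) * ((r + s) * (r ^ 2 + s ^ 2 - r * s)) = 0 := by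
    linear_combination -h0
  -- `r⁶ - s⁶` is the product of `r³ - s³`, `r + s` and `r² - r s + s²`.
  exact mul_ne_zero h.cube_sub_ne (mul_ne_zero h.add_ne h.quad_ne) this

/-- A geometric progression of four parameters; a chain that ends earlier also qualifies, since `0`
lies in every `skewKer`. -/
theorem commute_of_four (h : TorsionParam r s n) {c q : K} (hc : c ^ n = 1) (hq : q ^ n = 1)
    (h1 : q ≠ 1) (h2 : q ^ 2 ≠ 1) (h3 : q ^ 3 ≠ 1) {y x : A}
    (hx : x ∈ skewKer y [c, c * q, c * q ^ 2, c * q ^ 3]) : Commute (y ^ n) x := by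
  obtain ⟨ζ, hζ⟩ := h.exists_primitive
  have hc0 : c ≠ 0 := by
    rintro rfl
    simp [h.pos.ne'] at hc
  have hq0 : q ≠ 0 := by
    rintro rfl
    simp [h.pos.ne'] at hq
  refine commute_pow_of_mem_skewKer h.pos hζ ?_ ?_ hx
  · have e1 : q ≠ q ^ 2 := fun h0 => h1 (mul_left_cancel₀ hq0 (by linear_combination -h0))
    have e2 : q ≠ q ^ 3 := fun h0 => h2 (mul_left_cancel₀ hq0 (by linear_combination -h0))
    have e3 : q ^ 2 ≠ q ^ 3 := fun h0 =>
      h1 (mul_left_cancel₀ (pow_ne_zero 2 hq0) (by linear_combination -h0))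
    simp [hc0, h1, h2, h3, e1, e2, e3]
  · simp [mul_pow, pow_right_comm _ _ n, hc, hq]

/-- The same for a geometric progression of three parameters. -/
theorem commute_of_three (h : TorsionParam r s n) {c q : K} (hc : c ^ n = 1) (hq : q ^ n = 1)
    (h1 : q ≠ 1) (h2 : q ^ 2 ≠ 1) {y x : A}
    (hx : x ∈ skewKer y [c, c * q, c * q ^ 2]) : Commute (y ^ n) x := by
  obtain ⟨ζ, hζ⟩ := h.exists_primitive
  have hc0 : c ≠ 0 := by
    rintro rfl
    simp [h.pos.ne'] at hc
  have hq0 : q ≠ 0 := by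
    rintro rfl
    simp [h.pos.ne'] at hq
  refine commute_pow_of_mem_skewKer h.pos hζ ?_ ?_ hx
  · have e1 : q ≠ q ^ 2 := fun h0 => h1 (mul_left_cancel₀ hq0 (by linear_combination -h0))
    simp [hc0, h1, h2, e1]
  · simp [mul_pow, pow_right_comm _ _ n, hc, hq]

theorem s_div_r_pow (h : TorsionParam r s n) : (s / r) ^ n = 1 := by
  simp [div_pow, h.r_pow, h.s_pow]

/-- Chains with ratio `s / r`; those with ratio `r / s` are covered through `TorsionParam.symm`. -/
theorem commute_short (h : TorsionParam r s n) {c : K} (hc : c ^ n = 1) {y x : A}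
    (hx : x ∈ skewKer y [c, c * (s / r), c * (s / r) ^ 2, c * (s / r) ^ 3]) :
    Commute (y ^ n) x :=
  h.commute_of_four hc h.s_div_r_pow h.div_ne.1 h.div_ne.2.1 h.div_ne.2.2 hx

/-- Chains with ratio `s³ / r³`; those with ratio `r³ / s³` are covered through
`TorsionParam.symm`. -/
theorem commute_long (h : TorsionParam r s n) {c : K} (hc : c ^ n = 1) {y x : A}
    (hx : x ∈ skewKer y [c, c * (s ^ 3 / r ^ 3), c * (s ^ 3 / r ^ 3) ^ 2]) :
    Commute (y ^ n) x :=
  h.commute_of_three hc (by rw [← div_pow, pow_right_comm, h.s_div_r_pow, one_pow])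
    h.cube_div_ne.1 h.cube_div_ne.2 hx

/-- If the commutator of `y` with `x` is a combination of two elements that skew commute with `y`
with inverse parameters, then `yⁿ` commutes with `x`. This is the case of a simple root vector
and its negative counterpart, whose commutator is toral. -/
theorem commute_of_toral (h : TorsionParam r s n) {q ρ : K} (hq : q ^ n = 1) (h1 : q ≠ 1)
    (h2 : q ^ 2 ≠ 1) {y x w v : A} (hx : y * x = x * y + ρ • (w - v)) (hw : y * w = q • (w * y))
    (hv : y * v = q⁻¹ • (v * y)) : Commute (y ^ n) x := by
  obtain ⟨ζ, hζ⟩ := h.exists_primitive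
  have hq0 : q ≠ 0 := by
    rintro rfl
    simp [h.pos.ne'] at hq
  refine commute_pow_of_mem_skewKer (l := [1, q, q⁻¹]) h.pos hζ ?_ ?_
    (mem_skewKer_cons (x' := ρ • (w - v)) ?_ (Submodule.smul_mem _ _
      (mem_skewKer_cons (x' := (q - q⁻¹) • (v * y)) ?_ (Submodule.smul_mem _ _
        (mem_skewKer_of_skew ?_)))))
  · have e1 : q ≠ q⁻¹ := fun h0 => h2 (by rw [sq]; nth_rewrite 2 [h0]; exact mul_inv_cancel₀ hq0)
    have e2 : q⁻¹ ≠ 1 := fun h0 => h1 (inv_eq_one.1 h0)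
    simp [h1.symm, e2.symm, e1]
  · simp [hq]
  · rw [one_smul, hx]
  · rw [mul_sub, hw, hv, sub_mul]
    module
  · rw [← mul_assoc, hv, smul_mul_assoc]

end TorsionParam

theorem commute_pow_of_weight {g y : A} {a : K} {n : ℕ} (ha : a ^ n = 1)
    (h : g * y = a • (y * g)) : Commute (y ^ n) g := by
  have h' : SemiconjBy g y (a • y) := by rw [SemiconjBy, h, smul_mul_assoc]
  have := h'.pow_right n
  rw [smul_pow, ha, one_smul] at this
  exact Commute.symm this

theorem commute_weight_pow {g y : A} {a : K} {n : ℕ} (ha : a ^ n = 1)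
    (h : g * y = a • (y * g)) : Commute (g ^ n) y := by
  have h' : SemiconjBy y (a • g) g := by rw [SemiconjBy, h, mul_smul_comm]
  have := h'.pow_right n
  rw [smul_pow, ha, one_smul] at this
  exact Commute.symm this

namespace QuantumG2Rel

variable {r s : K} {n : ℕ} {e₁ e₂ V Y X Z f₁ f₂ w₁ w₂ v₁ v₂ : A}

/-! Below, each chain of skew commutators is displayed by its successive terms `x'`; the `n`-th
power of the element `y` named first commutes with the generator named second. -/

theorem commute_e1_e2 (h : QuantumG2Rel r s e₁ e₂ V Y X Z f₁ f₂ w₁ w₂ v₁ v₂)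
    (hp : TorsionParam r s n) : Commute (e₁ ^ n) e₂ := by
  have hs := hp.s_ne
  refine hp.symm.commute_short (c := s ^ 3)
    (by simp [mul_pow, pow_right_comm _ _ n, hp.r_pow, hp.s_pow]) ?_
  refine mem_skewKer_cons (x' := (1 : K) • V) ?_ (Submodule.smul_mem _ _ ?_)
  · linear_combination (norm := (match_scalars <;> field_simp <;> ring))
      h.e1_e2
  refine mem_skewKer_cons (x' := (1 : K) • Y) ?_ (Submodule.smul_mem _ _ ?_)
  · linear_combination (norm := (match_scalars <;> field_simp <;> ring))
      h.e1_V
  refine mem_skewKer_cons (x' := (1 : K) • X) ?_ (Submodule.smul_mem _ _ ?_)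
  · linear_combination (norm := (match_scalars <;> field_simp <;> ring))
      h.e1_Y
  refine mem_skewKer_of_skew ?_
  linear_combination (norm := (match_scalars <;> field_simp <;> ring))
    h.e1_X

theorem commute_e2_e1 (h : QuantumG2Rel r s e₁ e₂ V Y X Z f₁ f₂ w₁ w₂ v₁ v₂)
    (hp : TorsionParam r s n) : Commute (e₂ ^ n) e₁ := by
  have hr := hp.r_ne
  have hs := hp.s_ne
  refine hp.commute_long (c := (s ^ 3)⁻¹)
    (by simp [mul_pow, pow_right_comm _ _ n, hp.r_pow, hp.s_pow]) ?_
  refine mem_skewKer_cons (x' := (-(s ^ 3)⁻¹) • V) ?_ (Submodule.smul_mem _ _ ?_)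
  · linear_combination (norm := (
        simp only [mul_add, add_mul, mul_sub, sub_mul, smul_mul_assoc, mul_smul_comm, mul_assoc,
          smul_add, smul_sub, smul_smul]
        match_scalars <;> field_simp <;> ring))
      -(s ^ 3)⁻¹ • h.e1_e2
  refine mem_skewKer_of_skew ?_
  linear_combination (norm := (
      simp only [mul_add, add_mul, mul_sub, sub_mul, smul_mul_assoc, mul_smul_comm, mul_assoc,
        smul_add, smul_sub, smul_smul]
      match_scalars <;> field_simp <;> ring))
    -(r ^ 3)⁻¹ • h.V_e2

theorem commute_e1_f1 (h : QuantumG2Rel r s e₁ e₂ V Y X Z f₁ f₂ w₁ w₂ v₁ v₂)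
    (hp : TorsionParam r s n) : Commute (e₁ ^ n) f₁ := by
  have hr := hp.r_ne
  have hs := hp.s_ne
  refine hp.commute_of_toral (q := s / r) ?_ hp.div_ne.1 hp.div_ne.2.1 h.e1_f1 ?_ ?_
  · simp [div_pow, pow_right_comm _ _ n, hp.r_pow, hp.s_pow]
  · linear_combination (norm := (
        simp only [mul_add, add_mul, mul_sub, sub_mul, smul_mul_assoc, mul_smul_comm, mul_assoc,
          smul_add, smul_sub, smul_smul]
        match_scalars <;> field_simp <;> ring))
      -(s / r) • h.w1_e1
  · linear_combination (norm := (
        simp only [mul_add, add_mul, mul_sub, sub_mul, smul_mul_assoc, mul_smul_comm, mul_assoc,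
          smul_add, smul_sub, smul_smul]
        match_scalars <;> field_simp <;> ring))
      -(s / r)⁻¹ • h.v1_e1

theorem commute_e2_f2 (h : QuantumG2Rel r s e₁ e₂ V Y X Z f₁ f₂ w₁ w₂ v₁ v₂)
    (hp : TorsionParam r s n) : Commute (e₂ ^ n) f₂ := by
  have hr := hp.r_ne
  have hs := hp.s_ne
  refine hp.commute_of_toral (q := s ^ 3 / r ^ 3) ?_ hp.cube_div_ne.1 hp.cube_div_ne.2 h.e2_f2 ?_ ?_
  · simp [div_pow, pow_right_comm _ _ n, hp.r_pow, hp.s_pow]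
  · linear_combination (norm := (
        simp only [mul_add, add_mul, mul_sub, sub_mul, smul_mul_assoc, mul_smul_comm, mul_assoc,
          smul_add, smul_sub, smul_smul]
        match_scalars <;> field_simp <;> ring))
      -(s ^ 3 / r ^ 3) • h.w2_e2
  · linear_combination (norm := (
        simp only [mul_add, add_mul, mul_sub, sub_mul, smul_mul_assoc, mul_smul_comm, mul_assoc,
          smul_add, smul_sub, smul_smul]
        match_scalars <;> field_simp <;> ring))
      -(s ^ 3 / r ^ 3)⁻¹ • h.v2_e2

theorem commute_V_e1 (h : QuantumG2Rel r s e₁ e₂ V Y X Z f₁ f₂ w₁ w₂ v₁ v₂)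
    (hp : TorsionParam r s n) : Commute (V ^ n) e₁ := by
  have hr := hp.r_ne
  have hs := hp.s_ne
  refine hp.commute_short (c := (r * s ^ 2)⁻¹)
    (by simp [mul_pow, pow_right_comm _ _ n, hp.r_pow, hp.s_pow]) ?_
  refine mem_skewKer_cons (x' := (-(r * s ^ 2)⁻¹) • Y) ?_ (Submodule.smul_mem _ _ ?_)
  · linear_combination (norm := (
        simp only [mul_add, add_mul, mul_sub, sub_mul, smul_mul_assoc, mul_smul_comm, mul_assoc,
          smul_add, smul_sub, smul_smul]
        match_scalars <;> field_simp <;> ring))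
      -(r * s ^ 2)⁻¹ • h.e1_V
  refine mem_skewKer_cons (x' := (-(r ^ 2 * s)⁻¹) • Z) ?_ (Submodule.smul_mem _ _ ?_)
  · linear_combination (norm := (
        simp only [mul_add, add_mul, mul_sub, sub_mul, smul_mul_assoc, mul_smul_comm, mul_assoc,
          smul_add, smul_sub, smul_smul]
        match_scalars <;> field_simp <;> ring))
      -(r ^ 2 * s)⁻¹ • h.Y_V
  refine mem_skewKer_of_skew ?_
  linear_combination (norm := (
      simp only [mul_add, add_mul, mul_sub, sub_mul, smul_mul_assoc, mul_smul_comm, mul_assoc,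
        smul_add, smul_sub, smul_smul]
      match_scalars <;> field_simp <;> ring))
    -(r ^ 3)⁻¹ • h.Z_V hp.toGeneric

theorem commute_V_e2 (h : QuantumG2Rel r s e₁ e₂ V Y X Z f₁ f₂ w₁ w₂ v₁ v₂)
    (hp : TorsionParam r s n) : Commute (V ^ n) e₂ := by
  refine hp.commute_short (c := r ^ 3)
    (by simp [mul_pow, pow_right_comm _ _ n, hp.r_pow, hp.s_pow]) ?_
  refine mem_skewKer_of_skew ?_
  linear_combination (norm := (match_scalars <;> field_simp <;> ring))
    h.V_e2

theorem commute_V_f1 (h : QuantumG2Rel r s e₁ e₂ V Y X Z f₁ f₂ w₁ w₂ v₁ v₂)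
    (hp : TorsionParam r s n) : Commute (V ^ n) f₁ := by
  have hs := hp.s_ne
  have hv := h.weight h.v1_e1 h.v1_e2
  refine hp.symm.commute_short (c := 1) (by simp) ?_
  refine mem_skewKer_cons (x' := (-(r ^ 2 + r * s + s ^ 2)) • (e₂ * v₁))
    ?_ (Submodule.smul_mem _ _ ?_)
  · linear_combination (norm := (match_scalars <;> field_simp <;> ring))
      h.V_f1 hp.toGeneric
  refine mem_skewKer_of_skew ?_
  linear_combination (norm := (
      simp only [mul_add, add_mul, mul_sub, sub_mul, smul_mul_assoc, mul_smul_comm, mul_assoc,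
        smul_add, smul_sub, smul_smul]
      match_scalars <;> field_simp <;> ring))
    h.V_e2 * v₁ - (r / s) • (e₂ * hv.1)

theorem commute_V_f2 (h : QuantumG2Rel r s e₁ e₂ V Y X Z f₁ f₂ w₁ w₂ v₁ v₂)
    (hp : TorsionParam r s n) : Commute (V ^ n) f₂ := by
  have hr := hp.r_ne
  have hs := hp.s_ne
  have hw := h.weight h.w2_e1 h.w2_e2
  refine hp.commute_short (c := 1) (by simp) ?_
  refine mem_skewKer_cons (x' := (r ^ 3)⁻¹ • (e₁ * w₂)) ?_ (Submodule.smul_mem _ _ ?_)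
  · linear_combination (norm := (match_scalars <;> field_simp <;> ring))
      h.V_f2 hp.toGeneric
  refine mem_skewKer_cons (x' := (-(r * s ^ 2)⁻¹) • (Y * w₂)) ?_ (Submodule.smul_mem _ _ ?_)
  · linear_combination (norm := (
        simp only [mul_add, add_mul, mul_sub, sub_mul, smul_mul_assoc, mul_smul_comm, mul_assoc,
          smul_add, smul_sub, smul_smul]
        match_scalars <;> field_simp <;> ring))
      -(r * s ^ 2)⁻¹ • (h.e1_V * w₂) - (s / r) • (e₁ * hw.1)
  refine mem_skewKer_cons (x' := (-(r ^ 2 * s)⁻¹) • (Z * w₂)) ?_ (Submodule.smul_mem _ _ ?_)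
  · linear_combination (norm := (
        simp only [mul_add, add_mul, mul_sub, sub_mul, smul_mul_assoc, mul_smul_comm, mul_assoc,
          smul_add, smul_sub, smul_smul]
        match_scalars <;> field_simp <;> ring))
      -(r ^ 2 * s)⁻¹ • (h.Y_V * w₂) - (s / r) ^ 2 • (Y * hw.1)
  refine mem_skewKer_of_skew ?_
  linear_combination (norm := (
      simp only [mul_add, add_mul, mul_sub, sub_mul, smul_mul_assoc, mul_smul_comm, mul_assoc,
        smul_add, smul_sub, smul_smul]
      match_scalars <;> field_simp <;> ring))
    -(r ^ 3)⁻¹ • (h.Z_V hp.toGeneric * w₂) - (s / r) ^ 3 • (Z * hw.1)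

theorem commute_Y_e1 (h : QuantumG2Rel r s e₁ e₂ V Y X Z f₁ f₂ w₁ w₂ v₁ v₂)
    (hp : TorsionParam r s n) : Commute (Y ^ n) e₁ := by
  have hr := hp.r_ne
  have hs := hp.s_ne
  refine hp.commute_short (c := (r ^ 2 * s)⁻¹)
    (by simp [mul_pow, pow_right_comm _ _ n, hp.r_pow, hp.s_pow]) ?_
  refine mem_skewKer_cons (x' := (-(r ^ 2 * s)⁻¹) • X) ?_ (Submodule.smul_mem _ _ ?_)
  · linear_combination (norm := (
        simp only [mul_add, add_mul, mul_sub, sub_mul, smul_mul_assoc, mul_smul_comm, mul_assoc,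
          smul_add, smul_sub, smul_smul]
        match_scalars <;> field_simp <;> ring))
      -(r ^ 2 * s)⁻¹ • h.e1_Y
  refine mem_skewKer_of_skew ?_
  linear_combination (norm := (
      simp only [mul_add, add_mul, mul_sub, sub_mul, smul_mul_assoc, mul_smul_comm, mul_assoc,
        smul_add, smul_sub, smul_smul]
      match_scalars <;> field_simp <;> ring))
    -(r ^ 3)⁻¹ • h.X_Y hp.toGeneric

theorem commute_Y_e2 (h : QuantumG2Rel r s e₁ e₂ V Y X Z f₁ f₂ w₁ w₂ v₁ v₂)
    (hp : TorsionParam r s n) : Commute (Y ^ n) e₂ := by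
  have hs := hp.s_ne
  refine hp.symm.commute_short (c := r ^ 3 * s ^ 3)
    (by simp [mul_pow, pow_right_comm _ _ n, hp.r_pow, hp.s_pow]) ?_
  refine mem_skewKer_cons (x' := (r * (r ^ 2 - s ^ 2)) • (V * V)) ?_ (Submodule.smul_mem _ _ ?_)
  · linear_combination (norm := (
        simp only [mul_add, add_mul, mul_sub, sub_mul, smul_mul_assoc, mul_smul_comm, mul_assoc,
          smul_add, smul_sub, smul_smul]
        match_scalars <;> field_simp <;> ring))
      h.Y_e2
  refine mem_skewKer_cons (x' := (r ^ 2 * s + r ^ 3) • (V * Z)) ?_ (Submodule.smul_mem _ _ ?_)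
  · linear_combination (norm := (
        simp only [mul_add, add_mul, mul_sub, sub_mul, smul_mul_assoc, mul_smul_comm, mul_assoc,
          smul_add, smul_sub, smul_smul]
        match_scalars <;> field_simp <;> ring))
      h.Y_V * V + (r ^ 2 * s) • (V * h.Y_V) + h.Z_V hp.toGeneric
  refine mem_skewKer_cons (x' := (1 : K) • (Z * Z)) ?_ (Submodule.smul_mem _ _ ?_)
  · linear_combination (norm := (
        simp only [mul_add, add_mul, mul_sub, sub_mul, smul_mul_assoc, mul_smul_comm, mul_assoc,
          smul_add, smul_sub, smul_smul]
        match_scalars <;> field_simp <;> ring))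
      h.Y_V * Z + (r ^ 2 * s) • (V * h.Y_Z hp.toGeneric)
  refine mem_skewKer_of_skew ?_
  linear_combination (norm := (
      simp only [mul_add, add_mul, mul_sub, sub_mul, smul_mul_assoc, mul_smul_comm, mul_assoc,
        smul_add, smul_sub, smul_smul]
      match_scalars <;> field_simp <;> ring))
    h.Y_Z hp.toGeneric * Z + r ^ 3 • (Z * h.Y_Z hp.toGeneric)

theorem commute_Y_f1 (h : QuantumG2Rel r s e₁ e₂ V Y X Z f₁ f₂ w₁ w₂ v₁ v₂)
    (hp : TorsionParam r s n) : Commute (Y ^ n) f₁ := by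
  have hs := hp.s_ne
  have hv := h.weight h.v1_e1 h.v1_e2
  refine hp.symm.commute_short (c := 1) (by simp) ?_
  refine mem_skewKer_cons (x' := (-(r + s) ^ 2) • (V * v₁)) ?_ (Submodule.smul_mem _ _ ?_)
  · linear_combination (norm := (match_scalars <;> field_simp <;> ring))
      h.Y_f1 hp.toGeneric
  refine mem_skewKer_cons (x' := (1 : K) • (Z * v₁)) ?_ (Submodule.smul_mem _ _ ?_)
  · linear_combination (norm := (
        simp only [mul_add, add_mul, mul_sub, sub_mul, smul_mul_assoc, mul_smul_comm, mul_assoc,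
          smul_add, smul_sub, smul_smul]
        match_scalars <;> field_simp <;> ring))
      h.Y_V * v₁ - (r / s) • (V * hv.2.1)
  refine mem_skewKer_of_skew ?_
  linear_combination (norm := (
      simp only [mul_add, add_mul, mul_sub, sub_mul, smul_mul_assoc, mul_smul_comm, mul_assoc,
        smul_add, smul_sub, smul_smul]
      match_scalars <;> field_simp <;> ring))
    h.Y_Z hp.toGeneric * v₁ - (r / s) ^ 2 • (Z * hv.2.1)

theorem commute_Y_f2 (h : QuantumG2Rel r s e₁ e₂ V Y X Z f₁ f₂ w₁ w₂ v₁ v₂)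
    (hp : TorsionParam r s n) : Commute (Y ^ n) f₂ := by
  have hr := hp.r_ne
  have hs := hp.s_ne
  have hw := h.weight h.w2_e1 h.w2_e2
  refine hp.commute_short (c := 1) (by simp) ?_
  refine mem_skewKer_cons (x' := ((r ^ 3)⁻¹ * (1 - s ^ 2 / r ^ 2)) • (e₁ * (e₁ * w₂)))
    ?_ (Submodule.smul_mem _ _ ?_)
  · linear_combination (norm := (
        simp only [mul_add, add_mul, mul_sub, sub_mul, smul_mul_assoc, mul_smul_comm, mul_assoc,
          smul_add, smul_sub, smul_smul]
        match_scalars <;> field_simp <;> ring))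
      h.Y_f2 hp.toGeneric
  refine mem_skewKer_cons (x' := (-((r ^ 2 * s)⁻¹ ^ 2 * r ^ 3 + (r ^ 2 * s)⁻¹)) • (X * (e₁ * w₂)))
    ?_ (Submodule.smul_mem _ _ ?_)
  · linear_combination (norm := (
        simp only [mul_add, add_mul, mul_sub, sub_mul, smul_mul_assoc, mul_smul_comm, mul_assoc,
          smul_add, smul_sub, smul_smul]
        match_scalars <;> field_simp <;> ring))
      -(r ^ 2 * s)⁻¹ • (h.e1_Y * (e₁ * w₂)) - (r ^ 2 * s)⁻¹ ^ 2 • (e₁ * h.e1_Y * w₂)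
        - (r ^ 2 * s)⁻¹ ^ 2 • (h.e1_X * w₂) - (s / r) • (e₁ * (e₁ * hw.2.1))
  refine mem_skewKer_cons (x' := (-((r ^ 3)⁻¹ * (r ^ 2 * s)⁻¹)) • (X * (X * w₂)))
    ?_ (Submodule.smul_mem _ _ ?_)
  · linear_combination (norm := (
        simp only [mul_add, add_mul, mul_sub, sub_mul, smul_mul_assoc, mul_smul_comm, mul_assoc,
          smul_add, smul_sub, smul_smul]
        match_scalars <;> field_simp <;> ring))
      -(r ^ 3)⁻¹ • (h.X_Y hp.toGeneric * (e₁ * w₂)) - ((r ^ 3)⁻¹ * (r ^ 2 * s)⁻¹)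
        • (X * h.e1_Y * w₂)
        - (s / r) ^ 2 • (X * (e₁ * hw.2.1))
  refine mem_skewKer_of_skew ?_
  linear_combination (norm := (
      simp only [mul_add, add_mul, mul_sub, sub_mul, smul_mul_assoc, mul_smul_comm, mul_assoc,
        smul_add, smul_sub, smul_smul]
      match_scalars <;> field_simp <;> ring))
    -(r ^ 3)⁻¹ • (h.X_Y hp.toGeneric * (X * w₂)) - (r ^ 6)⁻¹ • (X * h.X_Y hp.toGeneric * w₂)
      - (s / r) ^ 3 • (X * (X * hw.2.1))

theorem commute_X_e1 (h : QuantumG2Rel r s e₁ e₂ V Y X Z f₁ f₂ w₁ w₂ v₁ v₂)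
    (hp : TorsionParam r s n) : Commute (X ^ n) e₁ := by
  have hr := hp.r_ne
  refine hp.commute_long (c := (r ^ 3)⁻¹)
    (by simp [mul_pow, pow_right_comm _ _ n, hp.r_pow, hp.s_pow]) ?_
  refine mem_skewKer_of_skew ?_
  linear_combination (norm := (
      simp only [mul_add, add_mul, mul_sub, sub_mul, smul_mul_assoc, mul_smul_comm, mul_assoc,
        smul_add, smul_sub, smul_smul]
      match_scalars <;> field_simp <;> ring))
    -(r ^ 3)⁻¹ • h.e1_X

theorem commute_X_e2 (h : QuantumG2Rel r s e₁ e₂ V Y X Z f₁ f₂ w₁ w₂ v₁ v₂)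
    (hp : TorsionParam r s n) : Commute (X ^ n) e₂ := by
  have hs := hp.s_ne
  have hY : Y * (Y * Y) ∈ skewKer X [r ^ 3 * s ^ 6 * (r ^ 3 / s ^ 3) ^ 2] := by
    refine mem_skewKer_of_skew ?_
    linear_combination (norm := (
        simp only [mul_add, add_mul, mul_sub, sub_mul, smul_mul_assoc, mul_smul_comm, mul_assoc,
          smul_add, smul_sub, smul_smul]
        match_scalars <;> field_simp <;> ring))
      h.X_Y hp.toGeneric * (Y * Y) + r ^ 3 • (Y * h.X_Y hp.toGeneric * Y)
        + r ^ 6 • (Y * (Y * h.X_Y hp.toGeneric))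
  refine hp.symm.commute_long (c := r ^ 3 * s ^ 6)
    (by simp [mul_pow, pow_right_comm _ _ n, hp.r_pow, hp.s_pow]) ?_
  refine mem_skewKer_cons (x' := (r ^ 3 - r * s ^ 2 - r ^ 2 * s) • (Y * V)
      + (r ^ 2 * s ^ 2 * (r ^ 2 + r * s - s ^ 2)) • (V * Y)) ?_
    (Submodule.add_mem _ (Submodule.smul_mem _ _ ?_) (Submodule.smul_mem _ _ ?_))
  · rw [h.X_e2, add_assoc]
  · refine mem_skewKer_cons (x' := (r ^ 3 * (r * (r ^ 3 - s ^ 3) / (r + s))) • (Y * (Y * Y))) ?_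
      (Submodule.smul_mem _ _ hY)
    linear_combination (norm := (
        simp only [mul_add, add_mul, mul_sub, sub_mul, smul_mul_assoc, mul_smul_comm, mul_assoc,
          smul_add, smul_sub, smul_smul]
        match_scalars <;> field_simp <;> ring))
      h.X_Y hp.toGeneric * V + r ^ 3 • (Y * h.X_V hp.toGeneric)
  · refine mem_skewKer_cons (x' := (r * (r ^ 3 - s ^ 3) / (r + s)) • (Y * (Y * Y))) ?_
      (Submodule.smul_mem _ _ hY)
    linear_combination (norm := (
        simp only [mul_add, add_mul, mul_sub, sub_mul, smul_mul_assoc, mul_smul_comm, mul_assoc,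
          smul_add, smul_sub, smul_smul]
        match_scalars <;> field_simp <;> ring))
      h.X_V hp.toGeneric * Y + (r ^ 3 * s ^ 3) • (V * h.X_Y hp.toGeneric)

theorem commute_X_f1 (h : QuantumG2Rel r s e₁ e₂ V Y X Z f₁ f₂ w₁ w₂ v₁ v₂)
    (hp : TorsionParam r s n) : Commute (X ^ n) f₁ := by
  have hs := hp.s_ne
  have hv := h.weight h.v1_e1 h.v1_e2
  refine hp.symm.commute_long (c := 1) (by simp) ?_
  refine mem_skewKer_cons (x' := (-(r ^ 2 + r * s + s ^ 2)) • (Y * v₁))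
    ?_ (Submodule.smul_mem _ _ ?_)
  · linear_combination (norm := (match_scalars <;> field_simp <;> ring))
      h.X_f1 hp.toGeneric
  refine mem_skewKer_of_skew ?_
  linear_combination (norm := (
      simp only [mul_add, add_mul, mul_sub, sub_mul, smul_mul_assoc, mul_smul_comm, mul_assoc,
        smul_add, smul_sub, smul_smul]
      match_scalars <;> field_simp <;> ring))
    h.X_Y hp.toGeneric * v₁ - (r ^ 3 / s ^ 3) • (Y * hv.2.2.1)

theorem commute_X_f2 (h : QuantumG2Rel r s e₁ e₂ V Y X Z f₁ f₂ w₁ w₂ v₁ v₂)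
    (hp : TorsionParam r s n) : Commute (X ^ n) f₂ := by
  have hr := hp.r_ne
  have hs := hp.s_ne
  have hw := h.weight h.w2_e1 h.w2_e2
  refine hp.commute_long (c := 1) (by simp) ?_
  refine mem_skewKer_cons
    (x' := ((r ^ 3)⁻¹ * (1 - s ^ 2 / r ^ 2) * (1 - s / r)) • (e₁ * (e₁ * (e₁ * w₂))))
      ?_ (Submodule.smul_mem _ _ ?_)
  · linear_combination (norm := (
        simp only [mul_add, add_mul, mul_sub, sub_mul, smul_mul_assoc, mul_smul_comm, mul_assoc,
          smul_add, smul_sub, smul_smul]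
        match_scalars <;> field_simp <;> ring))
      h.X_f2 hp.toGeneric
  refine mem_skewKer_of_skew ?_
  linear_combination (norm := (
      simp only [mul_add, add_mul, mul_sub, sub_mul, smul_mul_assoc, mul_smul_comm, mul_assoc,
        smul_add, smul_sub, smul_smul]
      match_scalars <;> field_simp <;> ring))
    -(r ^ 3)⁻¹ • (h.e1_X * (e₁ * (e₁ * w₂))) - (r ^ 6)⁻¹ • (e₁ * h.e1_X * (e₁ * w₂))
      - (r ^ 9)⁻¹ • (e₁ * (e₁ * h.e1_X) * w₂) - (s ^ 3 / r ^ 3) • (e₁ * (e₁ * (e₁ * hw.2.2.1)))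

theorem commute_Z_e1 (h : QuantumG2Rel r s e₁ e₂ V Y X Z f₁ f₂ w₁ w₂ v₁ v₂)
    (hp : TorsionParam r s n) : Commute (Z ^ n) e₁ := by
  have hr := hp.r_ne
  have hs := hp.s_ne
  refine hp.commute_long (c := (r ^ 3 * s ^ 3)⁻¹)
    (by simp [mul_pow, pow_right_comm _ _ n, hp.r_pow, hp.s_pow]) ?_
  refine mem_skewKer_cons (x' := (-((r ^ 3 * s ^ 3)⁻¹ * (r * (r ^ 3 - s ^ 3) / (r + s)))) • (Y * Y))
    ?_ (Submodule.smul_mem _ _ ?_)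
  · linear_combination (norm := (
        simp only [mul_add, add_mul, mul_sub, sub_mul, smul_mul_assoc, mul_smul_comm, mul_assoc,
          smul_add, smul_sub, smul_smul]
        match_scalars <;> field_simp <;> ring))
      -(r ^ 3 * s ^ 3)⁻¹ • h.e1_Z hp.toGeneric
  refine mem_skewKer_of_skew ?_
  linear_combination (norm := (
      simp only [mul_add, add_mul, mul_sub, sub_mul, smul_mul_assoc, mul_smul_comm, mul_assoc,
        smul_add, smul_sub, smul_smul]
      match_scalars <;> field_simp <;> ring))
    -(r ^ 3)⁻¹ • (h.Y_Z hp.toGeneric * Y) - (r ^ 6)⁻¹ • (Y * h.Y_Z hp.toGeneric)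

theorem commute_Z_e2 (h : QuantumG2Rel r s e₁ e₂ V Y X Z f₁ f₂ w₁ w₂ v₁ v₂)
    (hp : TorsionParam r s n) : Commute (Z ^ n) e₂ := by
  have hs := hp.s_ne
  refine hp.symm.commute_long (c := r ^ 6 * s ^ 3)
    (by simp [mul_pow, pow_right_comm _ _ n, hp.r_pow, hp.s_pow]) ?_
  refine mem_skewKer_cons (x' := (r * (r ^ 2 - s ^ 2) * (r ^ 3 - r ^ 2 * s)) • (V * (V * V)))
    ?_ (Submodule.smul_mem _ _ ?_)
  · linear_combination (norm := (
        simp only [mul_add, add_mul, mul_sub, sub_mul, smul_mul_assoc, mul_smul_comm, mul_assoc,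
          smul_add, smul_sub, smul_smul]
        match_scalars <;> field_simp <;> ring))
      h.Z_e2
  refine mem_skewKer_of_skew ?_
  linear_combination (norm := (
      simp only [mul_add, add_mul, mul_sub, sub_mul, smul_mul_assoc, mul_smul_comm, mul_assoc,
        smul_add, smul_sub, smul_smul]
      match_scalars <;> field_simp <;> ring))
    h.Z_V hp.toGeneric * (V * V) + r ^ 3 • (V * h.Z_V hp.toGeneric * V)
      + r ^ 6 • (V * (V * h.Z_V hp.toGeneric))

theorem commute_Z_f1 (h : QuantumG2Rel r s e₁ e₂ V Y X Z f₁ f₂ w₁ w₂ v₁ v₂)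
    (hp : TorsionParam r s n) : Commute (Z ^ n) f₁ := by
  have hs := hp.s_ne
  have hv := h.weight h.v1_e1 h.v1_e2
  refine hp.symm.commute_long (c := 1) (by simp) ?_
  refine mem_skewKer_cons
    (x' := (-((r ^ 2 + r * s + s ^ 2) * (r * (r ^ 2 - s ^ 2)))) • (V * (V * v₁)))
      ?_ (Submodule.smul_mem _ _ ?_)
  · linear_combination (norm := (
        simp only [mul_add, add_mul, mul_sub, sub_mul, smul_mul_assoc, mul_smul_comm, mul_assoc,
          smul_add, smul_sub, smul_smul]
        match_scalars <;> field_simp <;> ring))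
      h.Z_f1 hp.toGeneric
  refine mem_skewKer_of_skew ?_
  linear_combination (norm := (
      simp only [mul_add, add_mul, mul_sub, sub_mul, smul_mul_assoc, mul_smul_comm, mul_assoc,
        smul_add, smul_sub, smul_smul]
      match_scalars <;> field_simp <;> ring))
    h.Z_V hp.toGeneric * (V * v₁) + r ^ 3 • (V * h.Z_V hp.toGeneric * v₁)
      - (r ^ 3 / s ^ 3) • (V * (V * hv.2.2.2))

theorem commute_Z_f2 (h : QuantumG2Rel r s e₁ e₂ V Y X Z f₁ f₂ w₁ w₂ v₁ v₂)
    (hp : TorsionParam r s n) : Commute (Z ^ n) f₂ := by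
  have hr := hp.r_ne
  have hs := hp.s_ne
  have hw := h.weight h.w2_e1 h.w2_e2
  obtain ⟨α, β, hZ⟩ := h.Z_f2 hp.toGeneric
  have hY : Y * (Y * (Y * w₂)) ∈ skewKer Z [1 * (s ^ 3 / r ^ 3) ^ 2] := by
    refine mem_skewKer_of_skew ?_
    linear_combination (norm := (
        simp only [mul_add, add_mul, mul_sub, sub_mul, smul_mul_assoc, mul_smul_comm, mul_assoc,
          smul_add, smul_sub, smul_smul]
        match_scalars <;> field_simp <;> ring))
      -(r ^ 3)⁻¹ • (h.Y_Z hp.toGeneric * (Y * (Y * w₂)))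
        - (r ^ 6)⁻¹ • (Y * h.Y_Z hp.toGeneric * (Y * w₂))
        - (r ^ 9)⁻¹ • (Y * (Y * h.Y_Z hp.toGeneric) * w₂)
        - (s ^ 3 / r ^ 3) ^ 2 • (Y * (Y * (Y * hw.2.2.2)))
  refine hp.commute_long (c := 1) (by simp) ?_
  refine mem_skewKer_cons (x' := α • (X * w₂) + β • (Y * (e₁ * w₂))) (by rw [hZ, one_smul])
    (Submodule.add_mem _ (Submodule.smul_mem _ _ ?_) (Submodule.smul_mem _ _ ?_))
  · refine mem_skewKer_cons
      (x' := (-((r ^ 6 * s ^ 3)⁻¹ * (r * (r ^ 3 - s ^ 3) / (r + s) * (r ^ 3 - r ^ 2 * s)))) •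
        (Y * (Y * (Y * w₂)))) ?_
      (Submodule.smul_mem _ _ hY)
    linear_combination (norm := (
        simp only [mul_add, add_mul, mul_sub, sub_mul, smul_mul_assoc, mul_smul_comm, mul_assoc,
          smul_add, smul_sub, smul_smul]
        match_scalars <;> field_simp <;> ring))
      -(r ^ 6 * s ^ 3)⁻¹ • (h.X_Z hp.toGeneric * w₂) - (s ^ 3 / r ^ 3) • (X * hw.2.2.2)
  · refine mem_skewKer_cons
      (x' := (-((r ^ 6 * s ^ 3)⁻¹ * (r * (r ^ 3 - s ^ 3) / (r + s)))) • (Y * (Y * (Y * w₂)))) ?_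
      (Submodule.smul_mem _ _ hY)
    linear_combination (norm := (
        simp only [mul_add, add_mul, mul_sub, sub_mul, smul_mul_assoc, mul_smul_comm, mul_assoc,
          smul_add, smul_sub, smul_smul]
        match_scalars <;> field_simp <;> ring))
      -(r ^ 3)⁻¹ • (h.Y_Z hp.toGeneric * (e₁ * w₂))
        - (r ^ 6 * s ^ 3)⁻¹ • (Y * h.e1_Z hp.toGeneric * w₂)
        - (s ^ 3 / r ^ 3) • (Y * (e₁ * hw.2.2.2))

end QuantumG2Rel

end Powers

section Transport

variable {K A : Type*} [Field K] [Ring A] [Algebra K A]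

/-- The `n`-th power of each root vector commutes with all generators, toral ones included. -/
theorem QuantumG2Rel.commute_pow {r s : K} {n : ℕ} {e₁ e₂ V Y X Z f₁ f₂ w₁ w₂ v₁ v₂ : A}
    (h : QuantumG2Rel r s e₁ e₂ V Y X Z f₁ f₂ w₁ w₂ v₁ v₂) (hp : TorsionParam r s n) :
    ∀ y ∈ [e₁, X, Y, Z, V, e₂], ∀ g ∈ [e₁, e₂, f₁, f₂, w₁, w₂, v₁, v₂], Commute (y ^ n) g := by
  have toral : ∀ g : A, ∀ a b : K, a ^ n = 1 → b ^ n = 1 → g * e₁ = a • (e₁ * g) →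
      g * e₂ = b • (e₂ * g) → ∀ y ∈ [e₁, X, Y, Z, V, e₂], Commute (y ^ n) g := by
    intro g a b ha hb h₁ h₂
    have hm : ∀ i j : ℕ, (a ^ i * b ^ j) ^ n = 1 := fun i j => by
      rw [mul_pow, pow_right_comm, ha, pow_right_comm, hb, one_pow, one_pow, one_mul]
    obtain ⟨hV, hY, hX, hZ⟩ := h.weight h₁ h₂
    simp only [List.forall_mem_cons, List.not_mem_nil, false_implies, implies_true, and_true]
    exact ⟨commute_pow_of_weight ha h₁, commute_pow_of_weight (by simpa using hm 3 1) hX,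
      commute_pow_of_weight (by simpa using hm 2 1) hY, commute_pow_of_weight (hm 3 2) hZ,
      commute_pow_of_weight (by simpa using hm 1 1) hV, commute_pow_of_weight hb h₂⟩
  have hr := hp.r_pow
  have hs := hp.s_pow
  have hw₁ := toral w₁ _ _ (by simp [mul_pow, hr, hs]) (by simp [pow_right_comm _ _ n, hs])
    h.w1_e1 h.w1_e2
  have hw₂ := toral w₂ _ _ (by simp [pow_right_comm _ _ n, hr])
    (by simp [mul_pow, pow_right_comm _ _ n, hr, hs]) h.w2_e1 h.w2_e2
  have hv₁ := toral v₁ _ _ (by simp [mul_pow, hr, hs]) (by simp [pow_right_comm _ _ n, hr])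
    h.v1_e1 h.v1_e2
  have hv₂ := toral v₂ _ _ (by simp [pow_right_comm _ _ n, hs])
    (by simp [mul_pow, pow_right_comm _ _ n, hr, hs]) h.v2_e1 h.v2_e2
  simp only [List.forall_mem_cons, List.not_mem_nil, false_implies, implies_true, and_true]
    at hw₁ hw₂ hv₁ hv₂ ⊢
  obtain ⟨a1, a2, a3, a4, a5, a6⟩ := hw₁
  obtain ⟨b1, b2, b3, b4, b5, b6⟩ := hw₂
  obtain ⟨c1, c2, c3, c4, c5, c6⟩ := hv₁
  obtain ⟨d1, d2, d3, d4, d5, d6⟩ := hv₂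
  have hef : Commute e₁ f₂ := h.e1_f2
  have hfe : Commute e₂ f₁ := h.e2_f1
  exact ⟨⟨(Commute.refl _).pow_left n, h.commute_e1_e2 hp, h.commute_e1_f1 hp,
      hef.pow_left n, a1, b1, c1, d1⟩,
    ⟨h.commute_X_e1 hp, h.commute_X_e2 hp, h.commute_X_f1 hp, h.commute_X_f2 hp, a2, b2, c2, d2⟩,
    ⟨h.commute_Y_e1 hp, h.commute_Y_e2 hp, h.commute_Y_f1 hp, h.commute_Y_f2 hp, a3, b3, c3, d3⟩,
    ⟨h.commute_Z_e1 hp, h.commute_Z_e2 hp, h.commute_Z_f1 hp, h.commute_Z_f2 hp, a4, b4, c4, d4⟩,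
    ⟨h.commute_V_e1 hp, h.commute_V_e2 hp, h.commute_V_f1 hp, h.commute_V_f2 hp, a5, b5, c5, d5⟩,
    ⟨h.commute_e2_e1 hp, (Commute.refl _).pow_left n, hfe.pow_left n, h.commute_e2_f2 hp,
      a6, b6, c6, d6⟩⟩

/-- The Serre relations in expanded form yield the skew commutations `e1_X` and `V_e2`. -/
theorem RootVectorRel.of_serre {r s : K} (hr : r ≠ 0) (hs : s ≠ 0) {e₁ e₂ V Y X Z : A}
    (h₁ : e₂ ^ 2 * e₁ - ((r ^ 3)⁻¹ + (s ^ 3)⁻¹) • (e₂ * e₁ * e₂)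
      + ((r * s) ^ 3)⁻¹ • (e₁ * e₂ ^ 2) = 0)
    (h₂ : e₁ ^ 4 * e₂ - ((r + s) * (r ^ 2 + s ^ 2)) • (e₁ ^ 3 * e₂ * e₁)
      + (r * s * (r ^ 2 + s ^ 2) * (r ^ 2 + r * s + s ^ 2)) • (e₁ ^ 2 * e₂ * e₁ ^ 2)
      - ((r * s) ^ 3 * (r + s) * (r ^ 2 + s ^ 2)) • (e₁ * e₂ * e₁ ^ 3)
      + (r * s) ^ 6 • (e₂ * e₁ ^ 4) = 0)
    (hV : V = e₁ * e₂ - s ^ 3 • (e₂ * e₁)) (hY : Y = e₁ * V - (r * s ^ 2) • (V * e₁))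
    (hX : X = e₁ * Y - (r ^ 2 * s) • (Y * e₁)) (hZ : Z = Y * V - (r ^ 2 * s) • (V * Y)) :
    RootVectorRel r s e₁ e₂ V Y X Z where
  e1_e2 := by rw [hV, add_sub_cancel]
  e1_V := by rw [hY, add_sub_cancel]
  e1_Y := by rw [hX, add_sub_cancel]
  Y_V := by rw [hZ, add_sub_cancel]
  e1_X := by
    simp only [pow_succ, pow_zero, one_mul] at h₂
    subst hX hY hV
    linear_combination (norm := (
        simp only [mul_add, add_mul, mul_sub, sub_mul, smul_mul_assoc, mul_smul_comm, mul_assoc,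
          smul_add, smul_sub, smul_smul]
        module))
      h₂
  V_e2 := by
    simp only [sq] at h₁
    subst hV
    linear_combination (norm := (
        simp only [mul_add, add_mul, mul_sub, sub_mul, smul_mul_assoc, mul_smul_comm, mul_assoc,
          smul_add, smul_sub, smul_smul]
        match_scalars <;> field_simp <;> ring))
      (r ^ 3 * s ^ 3) • h₁

end Transport

/-! ### The algebra `U r s` and its opposite -/

section Application

variable {K : Type*} [Field K] {r s : K}

theorem mkAlgHom_eq_of_rel {a b : FreeAlgebra K Gen} (h : Rel r s a b) :
    RingQuot.mkAlgHom K (Rel r s) a = RingQuot.mkAlgHom K (Rel r s) b :=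
  RingQuot.mkAlgHom_rel K h

theorem toU_toral_comm {x y : Gen} (hx : x.IsToral) (hy : y.IsToral) :
    Commute (toU r s x) (toU r s y) := by
  have := mkAlgHom_eq_of_rel (Rel.toral_comm (r := r) (s := s) x y hx hy)
  rwa [map_mul, map_mul] at this

theorem ω_mul_inv (i : Fin 2) : ω r s i * toU r s (Gen.ωInv i) = 1 := by
  simpa [toU, ω] using mkAlgHom_eq_of_rel (Rel.ω_inv (r := r) (s := s) i)

theorem ω'_mul_inv (i : Fin 2) : ω' r s i * toU r s (Gen.ω'Inv i) = 1 := by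
  simpa [toU, ω'] using mkAlgHom_eq_of_rel (Rel.ω'_inv (r := r) (s := s) i)

theorem inv_mul_ω (i : Fin 2) : toU r s (Gen.ωInv i) * ω r s i = 1 :=
  (toU_toral_comm (.ωInv i) (.ω i)).trans (ω_mul_inv i)

theorem inv_mul_ω' (i : Fin 2) : toU r s (Gen.ω'Inv i) * ω' r s i = 1 :=
  (toU_toral_comm (.ω'Inv i) (.ω' i)).trans (ω'_mul_inv i)

theorem skew_of_conj {A : Type*} [Ring A] [Algebra K A] {w u x : A} {c : K} (huw : u * w = 1)
    (h : w * x * u = c • x) : w * x = c • (x * w) := by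
  rw [← smul_mul_assoc, ← h, mul_assoc, huw, mul_one]

theorem ω_mul_e (i j : Fin 2) : ω r s i * e r s j = chi r s i j • (e r s j * ω r s i) :=
  skew_of_conj (inv_mul_ω i) (by
    simpa [toU, ω, e] using mkAlgHom_eq_of_rel (Rel.ω_e (r := r) (s := s) i j))

theorem ω_mul_f (i j : Fin 2) : ω r s i * f r s j = (chi r s i j)⁻¹ • (f r s j * ω r s i) :=
  skew_of_conj (inv_mul_ω i) (by
    simpa [toU, ω, f] using mkAlgHom_eq_of_rel (Rel.ω_f (r := r) (s := s) i j))

theorem ω'_mul_e (i j : Fin 2) : ω' r s i * e r s j = chi' r s i j • (e r s j * ω' r s i) :=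
  skew_of_conj (inv_mul_ω' i) (by
    simpa [toU, ω', e] using mkAlgHom_eq_of_rel (Rel.ω'_e (r := r) (s := s) i j))

theorem ω'_mul_f (i j : Fin 2) : ω' r s i * f r s j = (chi' r s i j)⁻¹ • (f r s j * ω' r s i) :=
  skew_of_conj (inv_mul_ω' i) (by
    simpa [toU, ω', f] using mkAlgHom_eq_of_rel (Rel.ω'_f (r := r) (s := s) i j))

theorem e_mul_f_same (i : Fin 2) : e r s i * f r s i =
    f r s i * e r s i + (param r i - param s i)⁻¹ • (ω r s i - ω' r s i) := by
  have := mkAlgHom_eq_of_rel (Rel.e_f_same (r := r) (s := s) i)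
  simp only [map_sub, map_mul, map_smul] at this
  exact eq_add_of_sub_eq' this

theorem inv_sub_smul_sub_comm {A : Type*} [Ring A] [Algebra K A] (a b : K) (x y : A) :
    (a - b)⁻¹ • (x - y) = (b - a)⁻¹ • (y - x) := by
  rw [← neg_sub b, ← neg_sub y, inv_neg, neg_smul_neg]

theorem e_mul_f_same' (i : Fin 2) : e r s i * f r s i =
    f r s i * e r s i + (param s i - param r i)⁻¹ • (ω' r s i - ω r s i) := by
  rw [e_mul_f_same, inv_sub_smul_sub_comm]

theorem e_mul_f_ne {i j : Fin 2} (hij : i ≠ j) : e r s i * f r s j = f r s j * e r s i := by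
  have := mkAlgHom_eq_of_rel (Rel.e_f_ne (r := r) (s := s) i j hij)
  simp only [map_sub, map_mul, map_zero] at this
  exact sub_eq_zero.1 this

theorem quantumG2Rel_pos (hr : r ≠ 0) (hs : s ≠ 0) :
    QuantumG2Rel r s (e r s 0) (e r s 1) (E12 r s) (E112 r s) (E1112 r s) (E11212 r s)
      (f r s 0) (f r s 1) (ω r s 0) (ω r s 1) (ω' r s 0) (ω' r s 1) where
  toRootVectorRel := by
    refine .of_serre hr hs ?_ ?_ rfl rfl rfl rfl
    · have := mkAlgHom_eq_of_rel (Rel.serre_e₁ (r := r) (s := s))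
      simp only [map_sub, map_add, map_mul, map_smul, map_pow, map_zero] at this
      exact this
    · have := mkAlgHom_eq_of_rel (Rel.serre_e₂ (r := r) (s := s))
      simp only [map_sub, map_add, map_mul, map_smul, map_pow, map_zero] at this
      exact this
  e1_f1 := e_mul_f_same 0
  e1_f2 := e_mul_f_ne (by decide)
  e2_f1 := e_mul_f_ne (by decide)
  e2_f2 := e_mul_f_same 1
  w1_e1 := ω_mul_e 0 0
  w1_e2 := ω_mul_e 0 1
  w2_e1 := ω_mul_e 1 0
  w2_e2 := ω_mul_e 1 1
  v1_e1 := ω'_mul_e 0 0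
  v1_e2 := ω'_mul_e 0 1
  v2_e1 := ω'_mul_e 1 0
  v2_e2 := ω'_mul_e 1 1

theorem op_skew {A : Type*} [Ring A] [Algebra K A] {w x : A} {c c' : K} (hc : c ≠ 0)
    (hcc : c' = c) (h : w * x = c⁻¹ • (x * w)) :
    MulOpposite.op w * MulOpposite.op x = c' • (MulOpposite.op x * MulOpposite.op w) := by
  rw [← MulOpposite.op_mul, ← MulOpposite.op_mul, ← MulOpposite.op_smul, h, hcc,
    smul_inv_smul₀ hc]

open MulOpposite in
/-- Passing to the opposite algebra while exchanging `r` with `s`, `eᵢ` with `fᵢ` and `ωᵢ` with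
`ω'ᵢ` turns the negative root vectors into positive ones. -/
theorem quantumG2Rel_neg (hr : r ≠ 0) (hs : s ≠ 0) :
    QuantumG2Rel s r (op (f r s 0)) (op (f r s 1)) (op (F12 r s)) (op (F112 r s))
      (op (F1112 r s)) (op (F11212 r s)) (op (e r s 0)) (op (e r s 1)) (op (ω' r s 0))
      (op (ω' r s 1)) (op (ω r s 0)) (op (ω r s 1)) where
  toRootVectorRel := by
    refine .of_serre hs hr ?_ ?_ rfl ?_ ?_ ?_
    · have := congrArg op (mkAlgHom_eq_of_rel (Rel.serre_f₁ (r := r) (s := s)))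
      simp only [map_sub, map_add, map_mul, map_smul, map_pow, map_zero, op_add, op_sub, op_mul,
        op_pow, op_smul, op_zero, ← mul_assoc] at this
      rw [add_comm (s ^ 3)⁻¹, mul_comm s r]
      exact this
    · have := congrArg op (mkAlgHom_eq_of_rel (Rel.serre_f₂ (r := r) (s := s)))
      simp only [map_sub, map_add, map_mul, map_smul, map_pow, map_zero, op_add, op_sub, op_mul,
        op_pow, op_smul, op_zero, ← mul_assoc] at this
      rw [add_comm s r, add_comm (s ^ 2), mul_comm s r,
        show s ^ 2 + r * s + r ^ 2 = r ^ 2 + r * s + s ^ 2 by ring]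
      exact this
    · rw [mul_comm s]; rfl
    · rw [mul_comm _ r]; rfl
    · rw [mul_comm _ r]; rfl
  e1_f1 := congrArg op (e_mul_f_same' 0)
  e1_f2 := congrArg op (e_mul_f_ne (by decide))
  e2_f1 := congrArg op (e_mul_f_ne (by decide))
  e2_f2 := congrArg op (e_mul_f_same' 1)
  w1_e1 := op_skew (by simp [chi', hr, hs]) (by simp [chi', mul_comm]) (ω'_mul_f 0 0)
  w1_e2 := op_skew (by simp [chi', hr, hs]) (by simp [chi', mul_comm]) (ω'_mul_f 0 1)
  w2_e1 := op_skew (by simp [chi', hr, hs]) (by simp [chi', mul_comm]) (ω'_mul_f 1 0)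
  w2_e2 := op_skew (by simp [chi', hr, hs]) (by simp [chi', mul_comm]) (ω'_mul_f 1 1)
  v1_e1 := op_skew (by simp [chi, hr, hs]) (by simp [chi, mul_comm]) (ω_mul_f 0 0)
  v1_e2 := op_skew (by simp [chi, hr, hs]) (by simp [chi, mul_comm]) (ω_mul_f 0 1)
  v2_e1 := op_skew (by simp [chi, hr, hs]) (by simp [chi, mul_comm]) (ω_mul_f 1 0)
  v2_e2 := op_skew (by simp [chi, hr, hs]) (by simp [chi, mul_comm]) (ω_mul_f 1 1)

theorem commute_of_mul_eq_one {M : Type*} [Monoid M] {x w u : M} (hwu : w * u = 1)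
    (huw : u * w = 1) (h : Commute x w) : Commute x u :=
  Commute.units_inv_right (u := ⟨w, u, hwu, huw⟩) h

/-- Commuting with `eᵢ`, `fᵢ`, `ωᵢ`, `ω'ᵢ` suffices for centrality: the inverses of the toral
generators follow. -/
theorem mem_center_of_commute {x : U r s} (he : ∀ i, Commute x (e r s i))
    (hf : ∀ i, Commute x (f r s i)) (hω : ∀ i, Commute x (ω r s i))
    (hω' : ∀ i, Commute x (ω' r s i)) : x ∈ Subalgebra.center K (U r s) := by
  have hgen : ∀ g : Gen, Commute x (toU r s g) := by
    rintro (i | i | i | i | i | i)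
    · exact he i
    · exact hf i
    · exact hω i
    · exact commute_of_mul_eq_one (ω_mul_inv i) (inv_mul_ω i) (hω i)
    · exact hω' i
    · exact commute_of_mul_eq_one (ω'_mul_inv i) (inv_mul_ω' i) (hω' i)
  rw [Subalgebra.mem_center_iff]
  intro b
  obtain ⟨a, rfl⟩ := RingQuot.mkAlgHom_surjective K (Rel r s) b
  refine Commute.symm (?_ : Commute x _)
  induction a with
  | grade0 c => rw [AlgHom.commutes]; exact Algebra.commutes' c x |>.symm
  | grade1 g => exact hgen g
  | mul a b ha hb => rw [map_mul]; exact ha.mul_right hb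
  | add a b ha hb => rw [map_add]; exact ha.add_right hb

theorem E_pow_mem_center {n : ℕ} (hp : TorsionParam r s n) (α : PosRoot) :
    E r s α ^ n ∈ Subalgebra.center K (U r s) := by
  have h := (quantumG2Rel_pos hp.r_ne hp.s_ne).commute_pow hp (E r s α)
    (by cases α <;> simp [E])
  refine mem_center_of_commute ?_ ?_ ?_ ?_ <;> intro i <;> fin_cases i <;>
    exact h _ (by simp)

theorem F_pow_mem_center {n : ℕ} (hp : TorsionParam r s n) (α : PosRoot) :
    F r s α ^ n ∈ Subalgebra.center K (U r s) := by
  have h : ∀ g : U r s, _ → Commute (F r s α ^ n) g := fun g hg =>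
    Commute.unop ((quantumG2Rel_neg hp.r_ne hp.s_ne).commute_pow hp.symm (.op (F r s α))
      (by cases α <;> simp [F]) (.op g) hg)
  refine mem_center_of_commute ?_ ?_ ?_ ?_ <;> intro i <;> fin_cases i <;>
    exact h _ (by simp)

theorem chi_pow {n : ℕ} (hr : r ^ n = 1) (hs : s ^ n = 1) (i j : Fin 2) :
    chi r s i j ^ n = 1 := by
  fin_cases i <;> fin_cases j <;> simp [chi, mul_pow, pow_right_comm _ _ n, hr, hs]

theorem chi'_pow {n : ℕ} (hr : r ^ n = 1) (hs : s ^ n = 1) (i j : Fin 2) :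
    chi' r s i j ^ n = 1 := by
  fin_cases i <;> fin_cases j <;> simp [chi', mul_pow, pow_right_comm _ _ n, hr, hs]

theorem ω_pow_mem_center {n : ℕ} (hr : r ^ n = 1) (hs : s ^ n = 1) (k : Fin 2) :
    ω r s k ^ n ∈ Subalgebra.center K (U r s) :=
  mem_center_of_commute (fun i => commute_weight_pow (chi_pow hr hs k i) (ω_mul_e k i))
    (fun i => commute_weight_pow (by rw [inv_pow, chi_pow hr hs, inv_one]) (ω_mul_f k i))
    (fun i => (toU_toral_comm (.ω k) (.ω i)).pow_left n)
    (fun i => (toU_toral_comm (.ω k) (.ω' i)).pow_left n)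

theorem ω'_pow_mem_center {n : ℕ} (hr : r ^ n = 1) (hs : s ^ n = 1) (k : Fin 2) :
    ω' r s k ^ n ∈ Subalgebra.center K (U r s) :=
  mem_center_of_commute (fun i => commute_weight_pow (chi'_pow hr hs k i) (ω'_mul_e k i))
    (fun i => commute_weight_pow (by rw [inv_pow, chi'_pow hr hs, inv_one]) (ω'_mul_f k i))
    (fun i => (toU_toral_comm (.ω' k) (.ω i)).pow_left n)
    (fun i => (toU_toral_comm (.ω' k) (.ω' i)).pow_left n)

end Application

end TwoParamG2

theorem theorem3p2 {K : Type*} [Field K] (r s : K) (d d' : ℕ) (hd : 0 < d) (hd' : 0 < d')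
    (hr : IsPrimitiveRoot r d) (hs : IsPrimitiveRoot s d')
    (h3 : r ^ 3 ≠ s ^ 3) (h4 : r ^ 4 ≠ s ^ 4) (h6 : r ^ 2 + s ^ 2 - r * s ≠ 0) :
    (∀ α : TwoParamG2.PosRoot,
      TwoParamG2.E r s α ^ Nat.lcm d d' ∈ Subalgebra.center K (TwoParamG2.U r s)) ∧
    (∀ α : TwoParamG2.PosRoot,
      TwoParamG2.F r s α ^ Nat.lcm d d' ∈ Subalgebra.center K (TwoParamG2.U r s)) ∧
    (∀ k : Fin 2,
      TwoParamG2.ω r s k ^ Nat.lcm d d' - 1 ∈ Subalgebra.center K (TwoParamG2.U r s)) ∧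
    (∀ k : Fin 2,
      TwoParamG2.ω' r s k ^ Nat.lcm d d' - 1 ∈ Subalgebra.center K (TwoParamG2.U r s)) := by
  have hrn : r ^ Nat.lcm d d' = 1 := (hr.pow_eq_one_iff_dvd _).2 (Nat.dvd_lcm_left d d')
  have hsn : s ^ Nat.lcm d d' = 1 := (hs.pow_eq_one_iff_dvd _).2 (Nat.dvd_lcm_right d d')
  have hp : TwoParamG2.TorsionParam r s (Nat.lcm d d') :=
    { r_ne := (hr.isUnit hd.ne').ne_zero
      s_ne := (hs.isUnit hd'.ne').ne_zero
      cube_ne := h3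
      fourth_ne := h4
      quad_ne := h6
      pos := Nat.lcm_pos hd hd'
      exists_primitive := ⟨_, hr.pow_mul_pow_lcm hs hd.ne' hd'.ne'⟩
      r_pow := hrn
      s_pow := hsn }
  exact ⟨TwoParamG2.E_pow_mem_center hp, TwoParamG2.F_pow_mem_center hp,
    fun k => Subalgebra.sub_mem _ (TwoParamG2.ω_pow_mem_center hrn hsn k) (Subalgebra.one_mem _),
    fun k => Subalgebra.sub_mem _ (TwoParamG2.ω'_pow_mem_center hrn hsn k) (Subalgebra.one_mem _)⟩
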